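/- Let $\mathbb O$ be the real octonions with basis $e_0=1,e_1,\dots,e_7$. An $\mathbb O$-bimodule is a real vector space $M$ with unital $\mathbb R$-bilinear left and right multiplications by $\mathbb O$ such that, with $[p,q,m]=(pq)m-p(qm)$, $[m,p,q]=(mp)q-m(pq)$ and $[q,m,p]=(qm)p-q(mp)$, one has $[p,q,m]=-[q,p,m]$ and $[p,q,m]=[m,p,q]=[q,m,p]$ for all $p,q\in\mathbb O$, $m\in M$. Let $\operatorname{Re}M=\{m\in M:[p,q,m]=0\ \forall p,q\in\mathbb O\}$; then $M=\bigoplus_{i=0}^7 e_i\operatorname{Re}M$, and $\operatorname{Re}:M\to\operatorname{Re}M$ denotes the projection onto the summand $i=0$. For an $\mathbb R$-linear map $f:M\to M'$ of $\mathbb O$-bimodules put $A_p(x,f)=f(px)-pf(x)$; $f$ is (left) para-linear if $\operatorname{Re}A_p(x,f)=0$ for all $p\in\mathbb O$, $x\in M$. The regular composition of para-linear maps $g:M\to M'$ and $f:M'\to M''$ is the para-linear map $$(f\circledcirc g)(x)=f(g(x))-\sum_{j=1}^7 e_j\operatorname{Re}\big(f(A_{e_j}(x,g))\big).$$ Let $\mathcal{LO}$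 be the non-associative category (identities, but composition not required to be associative) of $\mathbb O$-bimodules, para-linear maps and regular compositions. The tensor product of $\mathbb O$-bimodules $M,X$ is the $\mathbb O$-bimodule $M\otimes_{\mathbb O}X=(\operatorname{Re}M\otimes_{\mathbb R}\operatorname{Re}X)\otimes_{\mathbb R}\mathbb O$, where $p(t\otimes q)=t\otimes pq$ and $(t\otimes q)p=t\otimes qp$; its real part is $\operatorname{Re}M\otimes_{\mathbb R}\operatorname{Re}X$ (identified with $t\mapsto t\otimes 1$). For $m=\sum_i e_im_i\in M$ and $x=\sum_j e_jx_j\in X$ with $m_i\in\operatorname{Re}M$, $x_j\in\operatorname{Re}X$, put $m\otimes_{\mathbb O}x=\sum_{i,j}(m_i\otimes x_j)\otimes e_ie_j$. Every $\mathbb R$-linear map $h:\operatorname{Re}N\to N'$, where $N,N'$ are $\mathbb O$-bimodules, has a unique para-linear extension $l\text{-}\mathrm{ext}\,h:N\to N'$, with $(l\text{-}\mathrm{ext}\,h)(py)=p\,h(y)$ for $p\in\mathbb O$, $y\in\operatorname{Re}N$. For a para-linear map $f:X\to X'$ let $f_M:\operatorname{Re}M\otimes_{\mathbb R}\operatorname{Re}X\to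 M\otimes_{\mathbb O}X'$ be the $\mathbb R$-linear map with $f_M(m\otimes x)=m\otimes_{\mathbb O}f(x)$. **Theorem.** Let $M$ be an $\mathbb O$-bimodule. For all para-linear maps $g:X\to X'$ and $f:X'\to X''$ of $\mathbb O$-bimodules, $$l\text{-}\mathrm{ext}\,f_M\circledcirc l\text{-}\mathrm{ext}\,g_M=l\text{-}\mathrm{ext}\,(f\circledcirc g)_M .$$ Consequently $X\mapsto M\otimes_{\mathbb O}X$, $f\mapsto l\text{-}\mathrm{ext}\,f_M$ is a covariant functor $\mathcal{LO}\to\mathcal{LO}$: it preserves regular compositions, and $l\text{-}\mathrm{ext}\,(1_X)_M=1_{M\otimes_{\mathbb O}X}$ for every $X$. -/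

import Mathlib

universe u

noncomputable section

namespace OctCat

/-! ## The octonions -/

/-- The octonions: `x = x 0 + ∑ i = 1..7, x i * eᵢ` with eight real coordinates. -/
def Octonion : Type := Fin 8 → ℝ

namespace Octonion

instance : AddCommGroup Octonion := inferInstanceAs (AddCommGroup (Fin 8 → ℝ))
instance : Module ℝ Octonion := inferInstanceAs (Module ℝ (Fin 8 → ℝ))

/-- The coordinates of an octonion. -/
def co (x : Octonion) (i : Fin 8) : ℝ := x i

@[ext] theorem ext {x y : Octonion} (h : ∀ i, x.co i = y.co i) : x = y := funext h

@[simp] theorem co_zero (i : Fin 8) : (0 : Octonion).co i = 0 := rfl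
@[simp] theorem co_add (x y : Octonion) (i : Fin 8) : (x + y).co i = x.co i + y.co i := rfl
@[simp] theorem co_neg (x : Octonion) (i : Fin 8) : (-x).co i = -x.co i := rfl
@[simp] theorem co_sub (x y : Octonion) (i : Fin 8) : (x - y).co i = x.co i - y.co i := rfl
@[simp] theorem co_smul (r : ℝ) (x : Octonion) (i : Fin 8) : (r • x).co i = r * x.co i := rfl

/-- The coordinate as a real linear functional. -/
def coL (i : Fin 8) : Octonion →ₗ[ℝ] ℝ := LinearMap.proj (φ := fun _ : Fin 8 => ℝ) i

@[simp] theorem coL_apply (i : Fin 8) (x : Octonion) : coL i x = x.co i := rfl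

/-- The multiplication `eᵢ eⱼ = εᵢⱼₖ eₖ - δᵢⱼ`, where `ε` is the skew-symmetric symbol of the 3-form
`e¹²³ + e¹⁴⁵ + e¹⁶⁷ + e²⁴⁶ - e²⁵⁷ - e³⁴⁷ - e³⁵⁶`, written in coordinates. -/
protected def mul (a b : Octonion) : Octonion :=
  let x := a.co
  let y := b.co
  ![
    x 0 * y 0 - x 1 * y 1 - x 2 * y 2 - x 3 * y 3 - x 4 * y 4 - x 5 * y 5 - x 6 * y 6 - x 7 * y 7,
    x 0 * y 1 + x 1 * y 0 + x 2 * y 3 - x 3 * y 2 + x 4 * y 5 - x 5 * y 4 + x 6 * y 7 - x 7 * y 6,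
    x 0 * y 2 + x 2 * y 0 + x 3 * y 1 - x 1 * y 3 + x 4 * y 6 - x 6 * y 4 - x 5 * y 7 + x 7 * y 5,
    x 0 * y 3 + x 3 * y 0 + x 1 * y 2 - x 2 * y 1 - x 4 * y 7 + x 7 * y 4 - x 5 * y 6 + x 6 * y 5,
    x 0 * y 4 + x 4 * y 0 + x 5 * y 1 - x 1 * y 5 + x 6 * y 2 - x 2 * y 6 - x 7 * y 3 + x 3 * y 7,
    x 0 * y 5 + x 5 * y 0 + x 1 * y 4 - x 4 * y 1 - x 7 * y 2 + x 2 * y 7 - x 6 * y 3 + x 3 * y 6,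
    x 0 * y 6 + x 6 * y 0 + x 7 * y 1 - x 1 * y 7 + x 2 * y 4 - x 4 * y 2 - x 3 * y 5 + x 5 * y 3,
    x 0 * y 7 + x 7 * y 0 + x 1 * y 6 - x 6 * y 1 - x 2 * y 5 + x 5 * y 2 - x 3 * y 4 + x 4 * y 3]

instance : Mul Octonion := ⟨Octonion.mul⟩

/-- The basis octonions `e 0 = 1`, `e 1`, …, `e 7`. -/
def e (i : Fin 8) : Octonion := fun j => if j = i then 1 else 0

instance : One Octonion := ⟨e 0⟩

theorem co_e (i j : Fin 8) : (e i).co j = if j = i then 1 else 0 := rfl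
theorem co_one (j : Fin 8) : (1 : Octonion).co j = if j = 0 then 1 else 0 := rfl

section
variable (a b : Octonion)
theorem co_mul0 : (a * b).co 0 = a.co 0 * b.co 0 - a.co 1 * b.co 1 - a.co 2 * b.co 2
    - a.co 3 * b.co 3 - a.co 4 * b.co 4 - a.co 5 * b.co 5 - a.co 6 * b.co 6 - a.co 7 * b.co 7 := rfl
theorem co_mul1 : (a * b).co 1 = a.co 0 * b.co 1 + a.co 1 * b.co 0 + a.co 2 * b.co 3
    - a.co 3 * b.co 2 + a.co 4 * b.co 5 - a.co 5 * b.co 4 + a.co 6 * b.co 7 - a.co 7 * b.co 6 := rfl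
theorem co_mul2 : (a * b).co 2 = a.co 0 * b.co 2 + a.co 2 * b.co 0 + a.co 3 * b.co 1
    - a.co 1 * b.co 3 + a.co 4 * b.co 6 - a.co 6 * b.co 4 - a.co 5 * b.co 7 + a.co 7 * b.co 5 := rfl
theorem co_mul3 : (a * b).co 3 = a.co 0 * b.co 3 + a.co 3 * b.co 0 + a.co 1 * b.co 2
    - a.co 2 * b.co 1 - a.co 4 * b.co 7 + a.co 7 * b.co 4 - a.co 5 * b.co 6 + a.co 6 * b.co 5 := rfl
theorem co_mul4 : (a * b).co 4 = a.co 0 * b.co 4 + a.co 4 * b.co 0 + a.co 5 * b.co 1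
    - a.co 1 * b.co 5 + a.co 6 * b.co 2 - a.co 2 * b.co 6 - a.co 7 * b.co 3 + a.co 3 * b.co 7 := rfl
theorem co_mul5 : (a * b).co 5 = a.co 0 * b.co 5 + a.co 5 * b.co 0 + a.co 1 * b.co 4
    - a.co 4 * b.co 1 - a.co 7 * b.co 2 + a.co 2 * b.co 7 - a.co 6 * b.co 3 + a.co 3 * b.co 6 := rfl
theorem co_mul6 : (a * b).co 6 = a.co 0 * b.co 6 + a.co 6 * b.co 0 + a.co 7 * b.co 1
    - a.co 1 * b.co 7 + a.co 2 * b.co 4 - a.co 4 * b.co 2 - a.co 3 * b.co 5 + a.co 5 * b.co 3 := rfl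
theorem co_mul7 : (a * b).co 7 = a.co 0 * b.co 7 + a.co 7 * b.co 0 + a.co 1 * b.co 6
    - a.co 6 * b.co 1 - a.co 2 * b.co 5 + a.co 5 * b.co 2 - a.co 3 * b.co 4 + a.co 4 * b.co 3 := rfl
end

theorem ext8 {x y : Octonion} (h0 : x.co 0 = y.co 0) (h1 : x.co 1 = y.co 1) (h2 : x.co 2 = y.co 2)
    (h3 : x.co 3 = y.co 3) (h4 : x.co 4 = y.co 4) (h5 : x.co 5 = y.co 5) (h6 : x.co 6 = y.co 6)
    (h7 : x.co 7 = y.co 7) : x = y := by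
  ext i
  fin_cases i <;> assumption

instance : NonAssocRing Octonion where
  mul := (· * ·)
  one := 1
  natCast n := n • (1 : Octonion)
  natCast_zero := zero_smul ℕ _
  natCast_succ n := by
    change (n + 1) • (1 : Octonion) = n • (1 : Octonion) + 1
    rw [add_smul, one_smul]
  intCast n := n • (1 : Octonion)
  intCast_ofNat n := natCast_zsmul _ _
  intCast_negSucc n := negSucc_zsmul _ _
  left_distrib a b c := by
    apply ext8 <;> simp only [co_mul0, co_mul1, co_mul2, co_mul3, co_mul4, co_mul5, co_mul6,
      co_mul7, co_add] <;> ring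
  right_distrib a b c := by
    apply ext8 <;> simp only [co_mul0, co_mul1, co_mul2, co_mul3, co_mul4, co_mul5, co_mul6,
      co_mul7, co_add] <;> ring
  zero_mul a := by
    apply ext8 <;> simp [co_mul0, co_mul1, co_mul2, co_mul3, co_mul4, co_mul5, co_mul6, co_mul7]
  mul_zero a := by
    apply ext8 <;> simp [co_mul0, co_mul1, co_mul2, co_mul3, co_mul4, co_mul5, co_mul6, co_mul7]
  one_mul a := by
    apply ext8 <;> simp [co_mul0, co_mul1, co_mul2, co_mul3, co_mul4, co_mul5, co_mul6, co_mul7,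
      co_one]
  mul_one a := by
    apply ext8 <;> simp [co_mul0, co_mul1, co_mul2, co_mul3, co_mul4, co_mul5, co_mul6, co_mul7,
      co_one]

instance : IsScalarTower ℝ Octonion Octonion where
  smul_assoc r a b := by
    change (r • a) * b = r • (a * b)
    apply ext8 <;> simp only [co_mul0, co_mul1, co_mul2, co_mul3, co_mul4, co_mul5, co_mul6,
      co_mul7, co_smul] <;> ring

instance : SMulCommClass ℝ Octonion Octonion where
  smul_comm r a b := by
    change r • (a * b) = a * (r • b)
    apply ext8 <;> simp only [co_mul0, co_mul1, co_mul2, co_mul3, co_mul4, co_mul5, co_mul6,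
      co_mul7, co_smul] <;> ring

theorem left_alt (p q r : Octonion) :
    (p * q) * r - p * (q * r) = -((q * p) * r - q * (p * r)) := by
  apply ext8 <;> simp only [co_mul0, co_mul1, co_mul2, co_mul3, co_mul4, co_mul5, co_mul6,
      co_mul7, co_sub, co_neg] <;> ring

theorem assoc_cyc (p q r : Octonion) :
    (p * q) * r - p * (q * r) = (r * p) * q - r * (p * q) := by
  apply ext8 <;> simp only [co_mul0, co_mul1, co_mul2, co_mul3, co_mul4, co_mul5, co_mul6,
      co_mul7, co_sub] <;> ring

theorem co_assoc_zero (p q r : Octonion) : ((p * q) * r - p * (q * r)).co 0 = 0 := by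
  simp only [co_mul0, co_mul1, co_mul2, co_mul3, co_mul4, co_mul5, co_mul6, co_mul7, co_sub]
  ring

theorem e_zero : e 0 = 1 := rfl

theorem eq_sum (p : Octonion) : p = ∑ i, p.co i • e i := by
  rw [Fin.sum_univ_eight]
  apply ext8 <;> simp [co_e]

/-- The multiplication rules: `e i * e j = e k`, `e j * e i = - e k` for the seven lines. -/
theorem e_mul_e :
    (e 1 * e 2 = e 3 ∧ e 1 * e 4 = e 5 ∧ e 1 * e 6 = e 7 ∧ e 2 * e 4 = e 6 ∧
      e 2 * e 5 = -e 7 ∧ e 3 * e 4 = -e 7 ∧ e 3 * e 5 = -e 6) := by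
  refine ⟨?_, ?_, ?_, ?_, ?_, ?_, ?_⟩ <;> apply ext8 <;>
    simp [co_mul0, co_mul1, co_mul2, co_mul3, co_mul4, co_mul5, co_mul6, co_mul7, co_e]

end Octonion

/-! ## Bimodules over the octonions -/

/-- A (unital, alternative) bimodule over the octonions: `lm p m` is `p m` and `rm p m` is `m p`.
The left associator `[p, q, m] = (p q) m - p (q m)` is alternating in `p, q`, and
`[p, q, m] = [m, p, q] = [q, m, p]`. -/
class OctBimodule (M : Type u) [AddCommGroup M] [Module ℝ M] where
  lm : Octonion →ₗ[ℝ] M →ₗ[ℝ] M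
  rm : Octonion →ₗ[ℝ] M →ₗ[ℝ] M
  one_lm : ∀ m, lm 1 m = m
  one_rm : ∀ m, rm 1 m = m
  left_alt : ∀ p q m, lm (p * q) m - lm p (lm q m) = -(lm (q * p) m - lm q (lm p m))
  assoc_eq₁ : ∀ p q m, lm (p * q) m - lm p (lm q m) = rm q (rm p m) - rm (p * q) m
  assoc_eq₂ : ∀ p q m, lm (p * q) m - lm p (lm q m) = rm p (lm q m) - lm q (rm p m)


open Octonion OctBimodule

theorem key_ring {A : Type u} [Ring A] {i j k m n p q Ri Rj Rk : A}
    (ii : i * i = -1) (mm : m * m = -1) (pp : p * p = -1)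
    (ji : j * i = -(i * j)) (ki : k * i = -(i * k))
    (mi : m * i = -(i * m)) (mj : m * j = -(j * m)) (mk : m * k = -(k * m))
    (nm : n * m = -(m * n)) (pm : p * m = -(m * p)) (qm : q * m = -(m * q))
    (pi : p * i = -(i * p)) (pj : p * j = -(j * p)) (pk : p * k = -(k * p))
    (hji : Rj * i - i * Rj = -k - j * i) (hii : Ri * i = i * Ri)
    (hki : Rk * i - i * Rk = j - k * i) (hk : Rj * Ri - Rk = k - i * j)
    (him : Ri * m - m * Ri = n - i * m) (hip : Ri * p - p * Ri = q - i * p) :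
    (2 : ℤ) • (i * j * (m * n)) = (2 : ℤ) • (k * (p * q)) := by
  have h1 : (k - i * j) * (Ri + i) = 0 := by
    have e1 : (Rj * i - i * Rj) * Ri = Rj * (i * Ri) - i * (Rj * Ri) := by noncomm_ring
    have e2 : Rj * Ri = k - i * j + Rk := by rw [← hk]; abel
    have e3 : Rj * (i * Ri) - i * (Rj * Ri)
        = (k - i * j) * i - i * (k - i * j) + (Rk * i - i * Rk) := by
      rw [← hii, ← mul_assoc, e2]; noncomm_ring
    rw [e3, hji, hki] at e1
    have e4 : i * j * i = j := by
      rw [mul_assoc, ji, mul_neg, ← mul_assoc, ii]; simp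
    have e5 : i * (i * j) = -j := by rw [← mul_assoc, ii]; simp
    have e6 : (k - i * j) * Ri = j - k * i - (k - i * j) * i + i * (k - i * j) - (j - k * i)
        - (j - k * i) := by
      have : (-k - j * i) * Ri = -((k - i * j) * Ri) := by rw [ji]; noncomm_ring
      rw [this] at e1
      rw [neg_eq_iff_eq_neg.mp e1]
      noncomm_ring
    rw [mul_add, e6, sub_mul, mul_sub, e4, e5, ki]
    noncomm_ring
  have gen : ∀ m n : A, m * m = -1 → m * i = -(i * m) → m * j = -(j * m) → m * k = -(k * m) →
      Ri * m - m * Ri = n - i * m → (k + i * j) * (Ri - m * n) = 0 := by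
    intro m n mm mi mj mk him
    have e1 : m * (k - i * j) = -(k + i * j) * m := by
      rw [mul_sub, mk, ← mul_assoc, mi, neg_mul, mul_assoc i m, mj]; noncomm_ring
    have e2 : (Ri + i) * m = m * Ri + n := by
      rw [add_mul]
      have : Ri * m = m * Ri + (n - i * m) := by rw [← him]; abel
      rw [this]; abel
    have e3 : m * ((k - i * j) * (Ri + i)) * m = 0 := by rw [h1]; simp
    rw [← mul_assoc, e1, mul_assoc, e2, mul_assoc, mul_add, ← mul_assoc, mm] at e3
    rw [← e3]; noncomm_ring
  have h2 := gen m n mm mi mj mk him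
  have h3 := gen p q pp pi pj pk hip
  have h4 : (k + i * j) * (m * n - p * q) = 0 := by
    have : (k + i * j) * (m * n - p * q)
      = (k + i * j) * (Ri - p * q) - (k + i * j) * (Ri - m * n) := by noncomm_ring
    rw [this, h2, h3, sub_zero]
  have h5 : (-k + i * j) * (m * n + p * q) = 0 := by
    have e1 : m * (k + i * j) = (-k + i * j) * m := by
      rw [mul_add, mk, ← mul_assoc, mi, neg_mul, mul_assoc i m, mj]; noncomm_ring
    have e2 : m * ((m * n - p * q) * m) = m * n + p * q := by
      rw [sub_mul, mul_assoc m n, nm, mul_assoc p q, qm, mul_neg p, ← mul_assoc p m, pm, neg_mul,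
        neg_neg, mul_sub]
      simp only [mul_neg, ← mul_assoc, mm]
      simp
    have e3 : m * ((k + i * j) * (m * n - p * q)) * m = 0 := by rw [h4]; simp
    rw [← mul_assoc, e1, mul_assoc, mul_assoc, e2] at e3
    exact e3
  have h6 : (2 : ℤ) • (i * j * (m * n)) - (2 : ℤ) • (k * (p * q))
      = (k + i * j) * (m * n - p * q) + (-k + i * j) * (m * n + p * q) := by noncomm_ring
  rw [h4, h5, add_zero] at h6
  exact sub_eq_zero.mp h6

theorem eq_zero_of_eq_neg {M : Type u} [AddCommGroup M] [Module ℝ M] {v : M} (h : v = -v) :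
    v = 0 := by
  have h2 : (2 : ℝ) • v = 0 := by
    rw [two_smul]; nth_rewrite 2 [h]; exact add_neg_cancel v
  exact (smul_eq_zero.mp h2).resolve_left two_ne_zero

section Structure

variable (M : Type u) [AddCommGroup M] [Module ℝ M] [OctBimodule M]

/-- Left multiplication by the basis octonion `e i`. -/
def Lop (i : Fin 8) : Module.End ℝ M := lm (e i)

/-- The nucleus of a bimodule: its real subspace of associative elements. -/
def nucleus : Submodule ℝ M where
  carrier := {m | ∀ p q : Octonion, lm (p * q) m - lm p (lm q m) = 0}
  zero_mem' := by intro p q; simp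
  add_mem' := by
    intro a b ha hb p q
    have h1 := ha p q
    have h2 := hb p q
    simp only [map_add]
    rw [add_sub_add_comm, h1, h2, add_zero]
  smul_mem' := by
    intro r a ha p q
    have h1 := ha p q
    simp only [map_smul]
    rw [← smul_sub, h1, smul_zero]

variable {M}

theorem nucleus_mul {m : M} (hm : m ∈ nucleus M) (p q : Octonion) :
    lm p (lm q m) = lm (p * q) m := (sub_eq_zero.mp (hm p q)).symm

theorem e_sq (i : Fin 8) (hi : i ≠ 0) : e i * e i = -1 := by
  fin_cases i <;> first | exact absurd rfl hi | skip
  all_goals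
    apply Octonion.ext8 <;>
      simp [co_mul0, co_mul1, co_mul2, co_mul3, co_mul4, co_mul5, co_mul6, co_mul7, co_e, co_one]

theorem e_anti (i j : Fin 8) (hi : i ≠ 0) (hj : j ≠ 0) (hij : i ≠ j) :
    e i * e j = -(e j * e i) := by
  fin_cases i <;> fin_cases j <;> first | exact absurd rfl hi | exact absurd rfl hj | exact absurd rfl hij | skip
  all_goals
    apply Octonion.ext8 <;>
      simp [co_mul0, co_mul1, co_mul2, co_mul3, co_mul4, co_mul5, co_mul6, co_mul7, co_e]

theorem Lop_sq (i : Fin 8) (hi : i ≠ 0) : Lop M i * Lop M i = -1 := by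
  ext x
  have h := OctBimodule.left_alt (e i) (e i) x
  have h2 : lm (e i * e i) x - lm (e i) (lm (e i) x) = 0 := eq_zero_of_eq_neg h
  rw [e_sq i hi, map_neg, LinearMap.neg_apply, one_lm] at h2
  simp only [Lop, Module.End.mul_apply, LinearMap.neg_apply, Module.End.one_apply]
  exact (sub_eq_zero.mp h2).symm

theorem Lop_anti (i j : Fin 8) (hi : i ≠ 0) (hj : j ≠ 0) (hij : i ≠ j) :
    Lop M i * Lop M j = -(Lop M j * Lop M i) := by
  ext x
  have h := OctBimodule.left_alt (e i) (e j) x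
  rw [e_anti i j hi hj hij, map_neg, LinearMap.neg_apply] at h
  simp only [Lop, Module.End.mul_apply, LinearMap.neg_apply]
  have : lm (e i) (lm (e j) x) = -(lm (e j) (lm (e i) x)) := by
    rw [neg_sub, sub_eq_sub_iff_add_eq_add, neg_add_cancel] at h
    exact eq_neg_of_add_eq_zero_left ((add_comm _ _).trans h.symm)
  exact this

/-- Right multiplication by the basis octonion `e i`. -/
def Rop (M : Type u) [AddCommGroup M] [Module ℝ M] [OctBimodule M] (i : Fin 8) :
    Module.End ℝ M := rm (e i)

theorem comm_RL (p q : Octonion) :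
    ((rm p * lm q - lm q * rm p : Module.End ℝ M)) = lm (p * q) - lm p * lm q := by
  ext x
  exact (OctBimodule.assoc_eq₂ p q x).symm

theorem mul_RR (p q : Octonion) :
    ((rm q * rm p - rm (p * q) : Module.End ℝ M)) = lm (p * q) - lm p * lm q := by
  ext x
  exact (OctBimodule.assoc_eq₁ p q x).symm

theorem key_op {i j k m n p q : Fin 8}
    (hi : i ≠ 0) (hj : j ≠ 0) (hk : k ≠ 0) (hm : m ≠ 0) (hn : n ≠ 0) (hp : p ≠ 0) (hq : q ≠ 0)
    (nij : j ≠ i) (nik : k ≠ i) (nim : m ≠ i) (njm : m ≠ j) (nkm : m ≠ k) (nnm : n ≠ m)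
    (npm : p ≠ m) (nqm : q ≠ m) (npi : p ≠ i) (npj : p ≠ j) (npk : p ≠ k)
    (hij : e i * e j = e k) (hki : e k * e i = e j) (him : e i * e m = e n)
    (hip : e i * e p = e q) :
    Lop M i * Lop M j * (Lop M m * Lop M n) = Lop M k * (Lop M p * Lop M q) := by
  have h := key_ring (A := Module.End ℝ M) (i := Lop M i) (j := Lop M j) (k := Lop M k)
    (m := Lop M m) (n := Lop M n) (p := Lop M p) (q := Lop M q)
    (Ri := Rop M i) (Rj := Rop M j) (Rk := Rop M k)
    (Lop_sq i hi) (Lop_sq m hm) (Lop_sq p hp)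
    (Lop_anti j i hj hi nij) (Lop_anti k i hk hi nik)
    (Lop_anti m i hm hi nim) (Lop_anti m j hm hj njm) (Lop_anti m k hm hk nkm)
    (Lop_anti n m hn hm nnm) (Lop_anti p m hp hm npm) (Lop_anti q m hq hm nqm)
    (Lop_anti p i hp hi npi) (Lop_anti p j hp hj npj) (Lop_anti p k hp hk npk)
    (by
      have := comm_RL (M := M) (e j) (e i)
      rw [e_anti j i hj hi nij, hij, map_neg] at this
      exact this)
    (by
      have := comm_RL (M := M) (e i) (e i)
      rw [e_sq i hi, map_neg] at this
      have h2 : (lm (1 : Octonion) : Module.End ℝ M) = 1 := by ext x; exact one_lm x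
      have h3 : (lm (e i) * lm (e i) : Module.End ℝ M) = -1 := Lop_sq i hi
      rw [h2, h3, sub_self] at this
      exact sub_eq_zero.mp this)
    (by
      have := comm_RL (M := M) (e k) (e i)
      rw [hki] at this
      exact this)
    (by
      have := mul_RR (M := M) (e i) (e j)
      rw [hij] at this
      exact this)
    (by
      have := comm_RL (M := M) (e i) (e m)
      rw [him] at this
      exact this)
    (by
      have := comm_RL (M := M) (e i) (e p)
      rw [hip] at this
      exact this)
  ext x
  have h' := LinearMap.congr_fun h x
  simp only [LinearMap.smul_apply] at h'
  have h2 : (2 : ℝ) • (Lop M i * Lop M j * (Lop M m * Lop M n)) x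
      = (2 : ℝ) • (Lop M k * (Lop M p * Lop M q)) x := by
    rw [two_smul, two_smul, ← two_zsmul, ← two_zsmul]; exact h'
  exact smul_right_injective M (two_ne_zero : (2 : ℝ) ≠ 0) h2


theorem word_out {A : Type u} [Ring A] {i j k m : A} (mi : i * m = -(m * i))
    (mj : j * m = -(m * j)) (mk : k * m = -(m * k)) : i * j * k * m = -(m * (i * j * k)) := by
  rw [mul_assoc, mk, mul_neg, ← mul_assoc, mul_assoc i j, mj, mul_neg, neg_mul, neg_neg,
    ← mul_assoc i m, mi]
  noncomm_ring

theorem word_1 {A : Type u} [Ring A] {i j k : A} (ij : i * j = -(j * i)) (ik : i * k = -(k * i)) :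
    i * j * k * i = i * (i * j * k) := by
  have h : k * i = -(i * k) := by rw [ik, neg_neg]
  have h2 : j * i = -(i * j) := by rw [ij, neg_neg]
  rw [mul_assoc, h, mul_neg, ← mul_assoc, mul_assoc i j, h2]
  noncomm_ring

theorem word_2 {A : Type u} [Ring A] {i j k : A} (ij : i * j = -(j * i)) (jk : k * j = -(j * k)) :
    i * j * k * j = j * (i * j * k) := by
  have h : j * i = -(i * j) := by rw [ij, neg_neg]
  rw [mul_assoc, jk, mul_neg, ← mul_assoc, mul_assoc i j, ← mul_assoc j, ← mul_assoc j, h]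
  noncomm_ring

theorem word_3 {A : Type u} [Ring A] {i j k : A} (ik : i * k = -(k * i)) (jk : j * k = -(k * j)) :
    i * j * k * k = k * (i * j * k) := by
  have h : i * j * k = k * (i * j) := by
    rw [mul_assoc i j k, jk, mul_neg, ← mul_assoc, ik]
    noncomm_ring
  nth_rewrite 1 [h]
  rw [mul_assoc]

variable (M) in
/-- The word `-L_i L_j L_k` of left multiplications. -/
def sop (i j k : Fin 8) : Module.End ℝ M := -(Lop M i * Lop M j * Lop M k)

theorem sop_out {i j k m : Fin 8} (hi : i ≠ 0) (hj : j ≠ 0) (hk : k ≠ 0) (hm : m ≠ 0)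
    (mi : i ≠ m) (mj : j ≠ m) (mk : k ≠ m) :
    sop M i j k * Lop M m = -(Lop M m * sop M i j k) := by
  have := word_out (Lop_anti (M := M) i m hi hm mi) (Lop_anti (M := M) j m hj hm mj)
    (Lop_anti (M := M) k m hk hm mk)
  rw [sop, neg_mul, this]; noncomm_ring

theorem sop_1 {i j k : Fin 8} (hi : i ≠ 0) (hj : j ≠ 0) (hk : k ≠ 0)
    (ij : i ≠ j) (ik : i ≠ k) :
    sop M i j k * Lop M i = Lop M i * sop M i j k := by
  have := word_1 (Lop_anti (M := M) i j hi hj ij) (Lop_anti (M := M) i k hi hk ik)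
  rw [sop, neg_mul, this]; noncomm_ring

theorem sop_2 {i j k : Fin 8} (hi : i ≠ 0) (hj : j ≠ 0) (hk : k ≠ 0)
    (ij : i ≠ j) (jk : k ≠ j) :
    sop M i j k * Lop M j = Lop M j * sop M i j k := by
  have := word_2 (Lop_anti (M := M) i j hi hj ij) (Lop_anti (M := M) k j hk hj jk)
  rw [sop, neg_mul, this]; noncomm_ring

theorem sop_3 {i j k : Fin 8} (hi : i ≠ 0) (hj : j ≠ 0) (hk : k ≠ 0)
    (ik : i ≠ k) (jk : j ≠ k) :
    sop M i j k * Lop M k = Lop M k * sop M i j k := by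
  have := word_3 (Lop_anti (M := M) i k hi hk ik) (Lop_anti (M := M) j k hj hk jk)
  rw [sop, neg_mul, this]; noncomm_ring

theorem sop_sq {i j k : Fin 8} (hi : i ≠ 0) (hj : j ≠ 0) (hk : k ≠ 0)
    (ij : i ≠ j) (ik : i ≠ k) (jk : j ≠ k) : sop M i j k * sop M i j k = 1 := by
  have h1 := sop_1 (M := M) hi hj hk ij ik
  have h2 := sop_2 (M := M) hi hj hk ij jk.symm
  have h3 := sop_3 (M := M) hi hj hk ik jk
  have a1 := Lop_sq (M := M) i hi
  have a2 := Lop_sq (M := M) j hj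
  have a3 := Lop_sq (M := M) k hk
  have b1 := Lop_anti (M := M) j i hj hi ij.symm
  have b2 := Lop_anti (M := M) k i hk hi ik.symm
  have b3 := Lop_anti (M := M) k j hk hj jk.symm
  have : sop M i j k * sop M i j k
      = -(sop M i j k * Lop M i * Lop M j * Lop M k) := by
    nth_rewrite 2 [sop]
    noncomm_ring
  rw [this, h1, mul_assoc (Lop M i), h2, mul_assoc (Lop M i), mul_assoc (Lop M j), h3, sop]
  have e1 : Lop M i * (Lop M j * (Lop M k * -(Lop M i * Lop M j * Lop M k)))
      = -(Lop M i * (Lop M j * (Lop M k * Lop M i) * Lop M j * Lop M k)) := by noncomm_ring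
  have e2 : Lop M i * (Lop M j * -(Lop M i * Lop M k) * Lop M j * Lop M k)
      = -(Lop M i * (Lop M j * Lop M i) * (Lop M k * Lop M j) * Lop M k) := by noncomm_ring
  have e3 : Lop M i * -(Lop M i * Lop M j) * -(Lop M j * Lop M k) * Lop M k
      = (Lop M i * Lop M i) * ((Lop M j * Lop M j) * (Lop M k * Lop M k)) := by noncomm_ring
  rw [e1, b2, e2, b1, b3, e3, a1, a2, a3]
  noncomm_ring

variable (M) in
/-- The operator `⅛ (1 + s) (1 + s') (1 + s'')` attached to three lines. -/
def Pop : Module.End ℝ M :=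
  (1 / 8 : ℝ) • ((1 + sop M 1 2 3) * (1 + sop M 1 4 5) * (1 + sop M 2 4 6))

theorem sop_comm_aux {A : Type u} [Ring A] {s x y z : A} (h1 : s * x = x * s)
    (h2 : s * y = -(y * s)) (h3 : s * z = -(z * s)) : s * -(x * y * z) = -(x * y * z) * s := by
  rw [mul_neg, ← mul_assoc, ← mul_assoc, h1, mul_assoc x, h2, mul_neg, neg_mul, mul_assoc x,
    mul_assoc y, h3]
  noncomm_ring

theorem comm_ab : sop M 1 2 3 * sop M 1 4 5 = sop M 1 4 5 * sop M 1 2 3 :=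
  sop_comm_aux (sop_1 (by decide) (by decide) (by decide) (by decide) (by decide))
    (sop_out (by decide) (by decide) (by decide) (by decide) (by decide) (by decide) (by decide))
    (sop_out (by decide) (by decide) (by decide) (by decide) (by decide) (by decide) (by decide))

theorem comm_ac : sop M 1 2 3 * sop M 2 4 6 = sop M 2 4 6 * sop M 1 2 3 :=
  sop_comm_aux (sop_2 (by decide) (by decide) (by decide) (by decide) (by decide))
    (sop_out (by decide) (by decide) (by decide) (by decide) (by decide) (by decide) (by decide))
    (sop_out (by decide) (by decide) (by decide) (by decide) (by decide) (by decide) (by decide))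

theorem comm_bc : sop M 1 4 5 * sop M 2 4 6 = sop M 2 4 6 * sop M 1 4 5 := by
  have h : sop M 2 4 6 = sop M 4 6 2 := by
    have h1 := Lop_anti (M := M) 6 2 (by decide) (by decide) (by decide)
    have h2 := Lop_anti (M := M) 4 2 (by decide) (by decide) (by decide)
    rw [sop, sop, mul_assoc (Lop M 4), h1, mul_neg, ← mul_assoc, h2]
    noncomm_ring
  rw [h]
  exact sop_comm_aux (sop_2 (by decide) (by decide) (by decide) (by decide) (by decide))
    (sop_out (by decide) (by decide) (by decide) (by decide) (by decide) (by decide) (by decide))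
    (sop_out (by decide) (by decide) (by decide) (by decide) (by decide) (by decide) (by decide))

theorem Pop_a : sop M 1 2 3 * Pop M = Pop M := by
  have h := sop_sq (M := M) (i := 1) (j := 2) (k := 3) (by decide) (by decide) (by decide)
    (by decide) (by decide) (by decide)
  have e0 : sop M 1 2 3 * (1 + sop M 1 2 3) = 1 + sop M 1 2 3 := by
    rw [mul_add, h, mul_one, add_comm]
  rw [Pop, mul_smul_comm, ← mul_assoc, ← mul_assoc, e0]

theorem Pop_b : sop M 1 4 5 * Pop M = Pop M := by
  have h := sop_sq (M := M) (i := 1) (j := 4) (k := 5) (by decide) (by decide) (by decide)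
    (by decide) (by decide) (by decide)
  have e1 : sop M 1 4 5 * (1 + sop M 1 2 3) = (1 + sop M 1 2 3) * sop M 1 4 5 := by
    rw [mul_add, add_mul, comm_ab]; simp
  have e0 : sop M 1 4 5 * (1 + sop M 1 4 5) = 1 + sop M 1 4 5 := by
    rw [mul_add, h, mul_one, add_comm]
  rw [Pop, mul_smul_comm, ← mul_assoc, ← mul_assoc, e1, mul_assoc (1 + sop M 1 2 3), e0]

theorem Pop_c : sop M 2 4 6 * Pop M = Pop M := by
  have h := sop_sq (M := M) (i := 2) (j := 4) (k := 6) (by decide) (by decide) (by decide)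
    (by decide) (by decide) (by decide)
  have e1 : sop M 2 4 6 * (1 + sop M 1 2 3) = (1 + sop M 1 2 3) * sop M 2 4 6 := by
    rw [mul_add, add_mul, comm_ac]; simp
  have e0 : sop M 2 4 6 * (1 + sop M 2 4 6) = 1 + sop M 2 4 6 := by
    rw [mul_add, h, mul_one, add_comm]
  have e2 : sop M 2 4 6 * (1 + sop M 1 4 5) = (1 + sop M 1 4 5) * sop M 2 4 6 := by
    rw [mul_add, add_mul, comm_bc]; simp
  rw [Pop, mul_smul_comm, ← mul_assoc, ← mul_assoc, e1, mul_assoc (1 + sop M 1 2 3), e2,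
    mul_assoc, mul_assoc, e0, ← mul_assoc]


theorem third_ring {A : Type u} [Ring A] {i j k m n p q : A} (ii : i * i = -1) (kk : k * k = -1)
    (ij : i * j = -(j * i)) (ik : i * k = -(k * i)) (jk : j * k = -(k * j))
    (h : i * j * (m * n) = k * (p * q)) :
    -(i * j * k) * -(i * m * n) = -(i * p * q) := by
  have e1 : p * q = -(k * (i * j * (m * n))) := by
    rw [h, ← mul_assoc k k, kk]; noncomm_ring
  have e2 : -(i * p * q) = i * k * i * j * (m * n) := by
    rw [mul_assoc, e1]; noncomm_ring
  have e3 : -(i * j * k) * -(i * m * n) = (i * j * k * i) * (m * n) := by noncomm_ring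
  rw [e2, e3, word_1 ij ik, ik]
  have e4 : i * (i * j * k) * (m * n) = (i * i) * (j * k) * (m * n) := by noncomm_ring
  have e5 : -(k * i) * i * j * (m * n) = -(k * (i * i) * j * (m * n)) := by noncomm_ring
  rw [e4, e5, ii, jk]
  noncomm_ring

theorem sop_third {i j k m n p q : Fin 8}
    (hi : i ≠ 0) (hj : j ≠ 0) (hk : k ≠ 0) (hm : m ≠ 0) (hn : n ≠ 0) (hp : p ≠ 0) (hq : q ≠ 0)
    (nij : j ≠ i) (nik : k ≠ i) (njk : j ≠ k) (nim : m ≠ i) (njm : m ≠ j) (nkm : m ≠ k)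
    (nnm : n ≠ m) (npm : p ≠ m) (nqm : q ≠ m) (npi : p ≠ i) (npj : p ≠ j) (npk : p ≠ k)
    (hij : e i * e j = e k) (hki : e k * e i = e j) (him : e i * e m = e n)
    (hip : e i * e p = e q) :
    sop M i j k * sop M i m n = sop M i p q :=
  third_ring (Lop_sq i hi) (Lop_sq k hk) (Lop_anti i j hi hj nij.symm) (Lop_anti i k hi hk nik.symm)
    (Lop_anti j k hj hk njk)
    (key_op hi hj hk hm hn hp hq nij nik nim njm nkm nnm npm nqm npi npj npk hij hki him hip)

theorem sop_cyc {i j k : Fin 8} (hi : i ≠ 0) (hj : j ≠ 0) (hk : k ≠ 0)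
    (ij : i ≠ j) (ik : i ≠ k) : sop M i j k = sop M j k i := by
  have h1 := Lop_anti (M := M) i j hi hj ij
  have h2 := Lop_anti (M := M) i k hi hk ik
  rw [sop, sop, h1, neg_mul, mul_assoc, h2]
  simp only [mul_neg, neg_neg, mul_assoc]

theorem mul_line {i j k : Fin 8} (hi : i ≠ 0) (hj : j ≠ 0) (ij : i ≠ j)
    (h : e i * e j = e k) : e j * e k = e i := by
  have h1 := Octonion.left_alt (e j) (e j) (e i)
  have h2 : e j * e i = -(e i * e j) := e_anti j i hj hi ij.symm
  have h3 : (e j * e j) * e i - e j * (e j * e i) = 0 := eq_zero_of_eq_neg h1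
  rw [e_sq j hj, h2, h] at h3
  rw [mul_neg, neg_mul, one_mul, sub_neg_eq_add] at h3
  exact (neg_add_eq_zero.mp h3).symm

theorem line_assoc {i j k : Fin 8} (hi : i ≠ 0)
    (h : e j * e k = e i) {y : M} (hy : sop M i j k y = y) :
    lm (e j * e k) y - lm (e j) (lm (e k) y) = 0 := by
  have h1 : Lop M i (sop M i j k y) = Lop M j (Lop M k y) := by
    have : Lop M i * sop M i j k = Lop M j * Lop M k := by
      have h3 : Lop M i * sop M i j k = -((Lop M i * Lop M i) * (Lop M j * Lop M k)) := by
        rw [sop]; noncomm_ring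
      rw [h3, Lop_sq i hi]; noncomm_ring
    exact LinearMap.congr_fun this y
  rw [hy] at h1
  rw [h]
  exact sub_eq_zero.mpr h1

theorem assoc_swap {p q : Octonion} {y : M} (h : lm (p * q) y - lm p (lm q y) = 0) :
    lm (q * p) y - lm q (lm p y) = 0 := by
  have := OctBimodule.left_alt p q y
  rw [h] at this
  exact neg_eq_zero.mp this.symm

theorem line_all {i j k : Fin 8} (hi : i ≠ 0) (hj : j ≠ 0) (hk : k ≠ 0)
    (ij : i ≠ j) (ik : i ≠ k) (jk : j ≠ k)
    (h : e i * e j = e k) {y : M} (hy : sop M i j k y = y) :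
    (lm (e i * e j) y - lm (e i) (lm (e j) y) = 0 ∧ lm (e j * e i) y - lm (e j) (lm (e i) y) = 0) ∧
    (lm (e j * e k) y - lm (e j) (lm (e k) y) = 0 ∧ lm (e k * e j) y - lm (e k) (lm (e j) y) = 0) ∧
    (lm (e k * e i) y - lm (e k) (lm (e i) y) = 0 ∧
      lm (e i * e k) y - lm (e i) (lm (e k) y) = 0) := by
  have h2 := mul_line hi hj ij h
  have h3 := mul_line hj hk jk h2
  have c1 := sop_cyc (M := M) hi hj hk ij ik
  have c2 := sop_cyc (M := M) hj hk hi jk ij.symm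
  have a1 := line_assoc hi h2 hy
  have a2 := line_assoc (i := j) (j := k) (k := i) hj h3 (by rw [← c1]; exact hy)
  have a3 := line_assoc (i := k) (j := i) (k := j) hk h (by rw [← c2, ← c1]; exact hy)
  exact ⟨⟨a3, assoc_swap a3⟩, ⟨a1, assoc_swap a1⟩, ⟨a2, assoc_swap a2⟩⟩

theorem mul_lines : (e 1 * e 2 = e 3 ∧ e 1 * e 4 = e 5 ∧ e 1 * e 6 = e 7 ∧ e 2 * e 4 = e 6 ∧
      e 2 * e 7 = e 5 ∧ e 4 * e 3 = e 7 ∧ e 3 * e 6 = e 5) ∧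
    (e 3 * e 1 = e 2 ∧ e 2 * e 3 = e 1 ∧ e 4 * e 5 = e 1 ∧ e 4 * e 6 = e 2 ∧ e 5 * e 1 = e 4 ∧
      e 3 * e 7 = e 4) := by
  refine ⟨⟨?_, ?_, ?_, ?_, ?_, ?_, ?_⟩, ?_, ?_, ?_, ?_, ?_, ?_⟩ <;> apply Octonion.ext8 <;>
    simp [co_mul0, co_mul1, co_mul2, co_mul3, co_mul4, co_mul5, co_mul6, co_mul7, co_e]

theorem Pop_lines : sop M 1 6 7 * Pop M = Pop M ∧ sop M 2 7 5 * Pop M = Pop M ∧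
    sop M 4 3 7 * Pop M = Pop M ∧ sop M 3 6 5 * Pop M = Pop M := by
  obtain ⟨⟨m1, m2, m3, m4, m5, m6, m7⟩, n1, n2, n3, n4, n5, n6⟩ := mul_lines
  have t1 := sop_third (M := M) (i := 1) (j := 2) (k := 3) (m := 4) (n := 5) (p := 6) (q := 7)
    (by decide) (by decide) (by decide) (by decide) (by decide) (by decide) (by decide)
    (by decide) (by decide) (by decide) (by decide) (by decide) (by decide)
    (by decide) (by decide) (by decide) (by decide) (by decide) (by decide) m1 n1 m2 m3
  have t2 := sop_third (M := M) (i := 2) (j := 3) (k := 1) (m := 4) (n := 6) (p := 7) (q := 5)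
    (by decide) (by decide) (by decide) (by decide) (by decide) (by decide) (by decide)
    (by decide) (by decide) (by decide) (by decide) (by decide) (by decide)
    (by decide) (by decide) (by decide) (by decide) (by decide) (by decide) n2 m1 m4 m5
  have t4 := sop_third (M := M) (i := 4) (j := 5) (k := 1) (m := 6) (n := 2) (p := 3) (q := 7)
    (by decide) (by decide) (by decide) (by decide) (by decide) (by decide) (by decide)
    (by decide) (by decide) (by decide) (by decide) (by decide) (by decide)
    (by decide) (by decide) (by decide) (by decide) (by decide) (by decide) n3 m2 n4 m6
  have t3 := sop_third (M := M) (i := 3) (j := 1) (k := 2) (m := 7) (n := 4) (p := 6) (q := 5)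
    (by decide) (by decide) (by decide) (by decide) (by decide) (by decide) (by decide)
    (by decide) (by decide) (by decide) (by decide) (by decide) (by decide)
    (by decide) (by decide) (by decide) (by decide) (by decide) (by decide) n1 n2 n6 m7
  have c1 : sop M 1 2 3 = sop M 2 3 1 :=
    sop_cyc (by decide) (by decide) (by decide) (by decide) (by decide)
  have c2 : sop M 2 3 1 = sop M 3 1 2 :=
    sop_cyc (by decide) (by decide) (by decide) (by decide) (by decide)
  have c3 : sop M 1 4 5 = sop M 4 5 1 :=
    sop_cyc (by decide) (by decide) (by decide) (by decide) (by decide)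
  have c4 : sop M 2 4 6 = sop M 4 6 2 :=
    sop_cyc (by decide) (by decide) (by decide) (by decide) (by decide)
  have c5 : sop M 4 3 7 = sop M 3 7 4 :=
    sop_cyc (by decide) (by decide) (by decide) (by decide) (by decide)
  have p4 : sop M 4 3 7 * Pop M = Pop M := by
    rw [← t4, ← c3, ← c4, mul_assoc, Pop_c, Pop_b]
  refine ⟨?_, ?_, p4, ?_⟩
  · rw [← t1, mul_assoc, Pop_b, Pop_a]
  · rw [← t2, ← c1, mul_assoc, Pop_c, Pop_a]
  · rw [← t3, ← c5, ← c2, ← c1, mul_assoc, p4, Pop_a]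

theorem assoc_of_basis {y : M}
    (h : ∀ i j : Fin 8, lm (e i * e j) y - lm (e i) (lm (e j) y) = 0) : y ∈ nucleus M := by
  intro p q
  rw [Octonion.eq_sum p, Octonion.eq_sum q]
  simp only [Finset.sum_mul, Finset.mul_sum, map_sum, LinearMap.sum_apply, smul_mul_assoc,
    mul_smul_comm, map_smul, LinearMap.smul_apply]
  simp only [← Finset.sum_sub_distrib, ← smul_sub]
  simp only [h, smul_zero, Finset.sum_const_zero]

theorem Pop_mem (x : M) : Pop M x ∈ nucleus M := by
  obtain ⟨⟨m1, m2, m3, m4, m5, m6, m7⟩, -⟩ := mul_lines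
  obtain ⟨p1, p2, p3, p4⟩ := Pop_lines (M := M)
  obtain ⟨⟨a1, a2⟩, ⟨a3, a4⟩, a5, a6⟩ := line_all (by decide) (by decide) (by decide) (by decide)
    (by decide) (by decide) m1 (LinearMap.congr_fun (Pop_a (M := M)) x)
  obtain ⟨⟨b1, b2⟩, ⟨b3, b4⟩, b5, b6⟩ := line_all (by decide) (by decide) (by decide) (by decide)
    (by decide) (by decide) m2 (LinearMap.congr_fun (Pop_b (M := M)) x)
  obtain ⟨⟨c1, c2⟩, ⟨c3, c4⟩, c5, c6⟩ := line_all (by decide) (by decide) (by decide) (by decide)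
    (by decide) (by decide) m4 (LinearMap.congr_fun (Pop_c (M := M)) x)
  obtain ⟨⟨d1, d2⟩, ⟨d3, d4⟩, d5, d6⟩ := line_all (by decide) (by decide) (by decide) (by decide)
    (by decide) (by decide) m3 (LinearMap.congr_fun p1 x)
  obtain ⟨⟨f1, f2⟩, ⟨f3, f4⟩, f5, f6⟩ := line_all (by decide) (by decide) (by decide) (by decide)
    (by decide) (by decide) m5 (LinearMap.congr_fun p2 x)
  obtain ⟨⟨g1, g2⟩, ⟨g3, g4⟩, g5, g6⟩ := line_all (by decide) (by decide) (by decide) (by decide)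
    (by decide) (by decide) m6 (LinearMap.congr_fun p3 x)
  obtain ⟨⟨k1, k2⟩, ⟨k3, k4⟩, k5, k6⟩ := line_all (by decide) (by decide) (by decide) (by decide)
    (by decide) (by decide) m7 (LinearMap.congr_fun p4 x)
  apply assoc_of_basis
  intro i j
  by_cases hi : i = 0
  · subst hi; rw [Octonion.e_zero, one_mul, one_lm, sub_self]
  by_cases hj : j = 0
  · subst hj; rw [Octonion.e_zero, mul_one, one_lm, sub_self]
  by_cases hij : i = j
  · subst hij; exact eq_zero_of_eq_neg (OctBimodule.left_alt _ _ _)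
  fin_cases i <;> first | exact absurd rfl hi | skip
  all_goals fin_cases j <;> first | exact absurd rfl hj | exact absurd rfl hij | skip
  all_goals simp only [Fin.reduceFinMk, Fin.mk_one]
  all_goals first
    | with_reducible exact a1 | with_reducible exact a2
    | with_reducible exact a3 | with_reducible exact a4
    | with_reducible exact a5 | with_reducible exact a6
    | with_reducible exact b1 | with_reducible exact b2
    | with_reducible exact b3 | with_reducible exact b4
    | with_reducible exact b5 | with_reducible exact b6
    | with_reducible exact c1 | with_reducible exact c2
    | with_reducible exact c3 | with_reducible exact c4
    | with_reducible exact c5 | with_reducible exact c6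
    | with_reducible exact d1 | with_reducible exact d2
    | with_reducible exact d3 | with_reducible exact d4
    | with_reducible exact d5 | with_reducible exact d6
    | with_reducible exact f1 | with_reducible exact f2
    | with_reducible exact f3 | with_reducible exact f4
    | with_reducible exact f5 | with_reducible exact f6
    | with_reducible exact g1 | with_reducible exact g2
    | with_reducible exact g3 | with_reducible exact g4
    | with_reducible exact g5 | with_reducible exact g6
    | with_reducible exact k1 | with_reducible exact k2
    | with_reducible exact k3 | with_reducible exact k4
    | with_reducible exact k5 | with_reducible exact k6


theorem conj_ring {A : Type u} [Ring A] {L a b c : A} (sa sb sc : ℤ) (LL : L * L = -1)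
    (ha : a * L = sa • (L * a)) (hb : b * L = sb • (L * b)) (hc : c * L = sc • (L * c)) :
    L * ((1 + a) * (1 + b) * (1 + c)) * L
      = -((1 + sa • a) * (1 + sb • b) * (1 + sc • c)) := by
  have f : ∀ (x : A) (s : ℤ), x * L = s • (L * x) → (1 + x) * L = L * (1 + s • x) := by
    intro x s h
    rw [add_mul, h, mul_add, one_mul, mul_one, mul_smul_comm]
  calc L * ((1 + a) * (1 + b) * (1 + c)) * L
      = L * ((1 + a) * ((1 + b) * ((1 + c) * L))) := by simp only [mul_assoc]
    _ = L * ((1 + a) * ((1 + b) * L) * (1 + sc • c)) := by rw [f c sc hc]; simp only [mul_assoc]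
    _ = L * ((1 + a) * L * ((1 + sb • b) * (1 + sc • c))) := by
        rw [f b sb hb]; simp only [mul_assoc]
    _ = (L * L) * ((1 + sa • a) * (1 + sb • b) * (1 + sc • c)) := by
        rw [f a sa ha]; simp only [mul_assoc]
    _ = _ := by rw [LL, neg_one_mul]

theorem sgn_out {i j k m : Fin 8} (hi : i ≠ 0) (hj : j ≠ 0) (hk : k ≠ 0) (hm : m ≠ 0)
    (mi : i ≠ m) (mj : j ≠ m) (mk : k ≠ m) :
    sop M i j k * Lop M m = (-1 : ℤ) • (Lop M m * sop M i j k) := by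
  rw [sop_out hi hj hk hm mi mj mk, neg_one_zsmul]

theorem sgn_1 {i j k : Fin 8} (hi : i ≠ 0) (hj : j ≠ 0) (hk : k ≠ 0)
    (ij : i ≠ j) (ik : i ≠ k) :
    sop M i j k * Lop M i = (1 : ℤ) • (Lop M i * sop M i j k) := by
  rw [sop_1 hi hj hk ij ik, one_zsmul]

theorem sgn_2 {i j k : Fin 8} (hi : i ≠ 0) (hj : j ≠ 0) (hk : k ≠ 0)
    (ij : i ≠ j) (jk : k ≠ j) :
    sop M i j k * Lop M j = (1 : ℤ) • (Lop M j * sop M i j k) := by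
  rw [sop_2 hi hj hk ij jk, one_zsmul]

theorem sgn_3 {i j k : Fin 8} (hi : i ≠ 0) (hj : j ≠ 0) (hk : k ≠ 0)
    (ik : i ≠ k) (jk : j ≠ k) :
    sop M i j k * Lop M k = (1 : ℤ) • (Lop M k * sop M i j k) := by
  rw [sop_3 hi hj hk ik jk, one_zsmul]

theorem Pop_sum : Pop M - ∑ i : Fin 7, Lop M i.succ * Pop M * Lop M i.succ = 1 := by
  have h1 := conj_ring (A := Module.End ℝ M) 1 1 (-1) (Lop_sq 1 (by decide))
    (sgn_1 (j := 2) (k := 3) (by decide) (by decide) (by decide) (by decide) (by decide))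
    (sgn_1 (j := 4) (k := 5) (by decide) (by decide) (by decide) (by decide) (by decide))
    (sgn_out (i := 2) (j := 4) (k := 6) (by decide) (by decide) (by decide) (by decide)
      (by decide) (by decide) (by decide))
  have h2 := conj_ring (A := Module.End ℝ M) 1 (-1) 1 (Lop_sq 2 (by decide))
    (sgn_2 (i := 1) (k := 3) (by decide) (by decide) (by decide) (by decide) (by decide))
    (sgn_out (i := 1) (j := 4) (k := 5) (by decide) (by decide) (by decide) (by decide)
      (by decide) (by decide) (by decide))
    (sgn_1 (j := 4) (k := 6) (by decide) (by decide) (by decide) (by decide) (by decide))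
  have h3 := conj_ring (A := Module.End ℝ M) 1 (-1) (-1) (Lop_sq 3 (by decide))
    (sgn_3 (i := 1) (j := 2) (by decide) (by decide) (by decide) (by decide) (by decide))
    (sgn_out (i := 1) (j := 4) (k := 5) (by decide) (by decide) (by decide) (by decide)
      (by decide) (by decide) (by decide))
    (sgn_out (i := 2) (j := 4) (k := 6) (by decide) (by decide) (by decide) (by decide)
      (by decide) (by decide) (by decide))
  have h4 := conj_ring (A := Module.End ℝ M) (-1) 1 1 (Lop_sq 4 (by decide))
    (sgn_out (i := 1) (j := 2) (k := 3) (by decide) (by decide) (by decide) (by decide)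
      (by decide) (by decide) (by decide))
    (sgn_2 (i := 1) (k := 5) (by decide) (by decide) (by decide) (by decide) (by decide))
    (sgn_2 (i := 2) (k := 6) (by decide) (by decide) (by decide) (by decide) (by decide))
  have h5 := conj_ring (A := Module.End ℝ M) (-1) 1 (-1) (Lop_sq 5 (by decide))
    (sgn_out (i := 1) (j := 2) (k := 3) (by decide) (by decide) (by decide) (by decide)
      (by decide) (by decide) (by decide))
    (sgn_3 (i := 1) (j := 4) (by decide) (by decide) (by decide) (by decide) (by decide))
    (sgn_out (i := 2) (j := 4) (k := 6) (by decide) (by decide) (by decide) (by decide)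
      (by decide) (by decide) (by decide))
  have h6 := conj_ring (A := Module.End ℝ M) (-1) (-1) 1 (Lop_sq 6 (by decide))
    (sgn_out (i := 1) (j := 2) (k := 3) (by decide) (by decide) (by decide) (by decide)
      (by decide) (by decide) (by decide))
    (sgn_out (i := 1) (j := 4) (k := 5) (by decide) (by decide) (by decide) (by decide)
      (by decide) (by decide) (by decide))
    (sgn_3 (i := 2) (j := 4) (by decide) (by decide) (by decide) (by decide) (by decide))
  have h7 := conj_ring (A := Module.End ℝ M) (-1) (-1) (-1) (Lop_sq 7 (by decide))
    (sgn_out (i := 1) (j := 2) (k := 3) (by decide) (by decide) (by decide) (by decide)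
      (by decide) (by decide) (by decide))
    (sgn_out (i := 1) (j := 4) (k := 5) (by decide) (by decide) (by decide) (by decide)
      (by decide) (by decide) (by decide))
    (sgn_out (i := 2) (j := 4) (k := 6) (by decide) (by decide) (by decide) (by decide)
      (by decide) (by decide) (by decide))
  rw [Fin.sum_univ_seven]
  change Pop M - (Lop M 1 * Pop M * Lop M 1 + Lop M 2 * Pop M * Lop M 2 + Lop M 3 * Pop M * Lop M 3
    + Lop M 4 * Pop M * Lop M 4 + Lop M 5 * Pop M * Lop M 5 + Lop M 6 * Pop M * Lop M 6
    + Lop M 7 * Pop M * Lop M 7) = 1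
  simp only [Pop, mul_smul_comm, smul_mul_assoc, h1, h2, h3, h4, h5, h6, h7, one_smul, neg_smul,
    ← smul_add, ← smul_sub]
  generalize sop M 1 2 3 = a
  generalize sop M 1 4 5 = b
  generalize sop M 2 4 6 = c
  have : (1 + a) * (1 + b) * (1 + c) -
      (-((1 + a) * (1 + b) * (1 + -c)) + -((1 + a) * (1 + -b) * (1 + c))
        + -((1 + a) * (1 + -b) * (1 + -c)) + -((1 + -a) * (1 + b) * (1 + c))
        + -((1 + -a) * (1 + b) * (1 + -c)) + -((1 + -a) * (1 + -b) * (1 + c))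
        + -((1 + -a) * (1 + -b) * (1 + -c))) = (8 : ℤ) • (1 : Module.End ℝ M) := by
    noncomm_ring
  rw [this, ← Int.cast_smul_eq_zsmul ℝ, smul_smul]
  norm_num

/-- Octonionic counterpart of `sop`. -/
def sO (i j k : Fin 8) (p : Octonion) : Octonion := -(e i * (e j * (e k * p)))

theorem sop_nucleus {y : M} (hy : y ∈ nucleus M) (i j k : Fin 8) (p : Octonion) :
    sop M i j k (lm p y) = lm (sO i j k p) y := by
  change -(lm (e i) (lm (e j) (lm (e k) (lm p y)))) = lm (sO i j k p) y
  rw [nucleus_mul hy, nucleus_mul hy, nucleus_mul hy, sO, map_neg, LinearMap.neg_apply]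

theorem Pop_nucleus {y : M} (hy : y ∈ nucleus M) (p : Octonion) :
    Pop M (lm p y) = p.co 0 • y := by
  have h1 : (1 + sop M 2 4 6) (lm p y) = lm (p + sO 2 4 6 p) y := by
    rw [LinearMap.add_apply, Module.End.one_apply, sop_nucleus hy, map_add lm p, LinearMap.add_apply]
  set q := p + sO 2 4 6 p with hq
  have h2 : (1 + sop M 1 4 5) (lm q y) = lm (q + sO 1 4 5 q) y := by
    rw [LinearMap.add_apply, Module.End.one_apply, sop_nucleus hy, map_add lm q, LinearMap.add_apply]
  set r := q + sO 1 4 5 q with hr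
  have h3 : (1 + sop M 1 2 3) (lm r y) = lm (r + sO 1 2 3 r) y := by
    rw [LinearMap.add_apply, Module.End.one_apply, sop_nucleus hy, map_add lm r, LinearMap.add_apply]
  have h4 : r + sO 1 2 3 r = (8 * p.co 0) • (1 : Octonion) := by
    rw [hr, hq]
    apply Octonion.ext8 <;>
      simp [sO, co_mul0, co_mul1, co_mul2, co_mul3, co_mul4, co_mul5, co_mul6, co_mul7, co_e,
        co_one] <;> ring
  rw [Pop, LinearMap.smul_apply, Module.End.mul_apply, Module.End.mul_apply, h1, h2, h3, h4,
    map_smul, LinearMap.smul_apply, one_lm, smul_smul]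
  congr 1
  ring


variable (M) in
/-- The map `(y₀, …, y₇) ↦ ∑ i, eᵢ yᵢ` on tuples of associative elements. -/
def assemble : (Fin 8 → nucleus M) →ₗ[ℝ] M :=
  ∑ i, lm (e i) ∘ₗ (nucleus M).subtype ∘ₗ LinearMap.proj i

theorem assemble_apply (y : Fin 8 → nucleus M) : assemble M y = ∑ i, lm (e i) (y i : M) := by
  simp [assemble]

theorem co_conj_mul (i j : Fin 8) : (e j * e i).co 0 = if i = j then (if j = 0 then 1 else -1) else 0 := by
  fin_cases i <;> fin_cases j <;> simp [co_mul0, co_e]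

/-- The decomposition of `M` as the direct sum of the subspaces `eᵢ 𝒜(M)`, where `𝒜(M)` is the
nucleus. -/
theorem assemble_bijective : Function.Bijective (assemble M) := by
  constructor
  · rw [← LinearMap.ker_eq_bot, LinearMap.ker_eq_bot']
    intro y hy
    funext j
    have h : Pop M (lm (e j) (assemble M y)) = 0 := by rw [hy]; simp
    rw [assemble_apply, map_sum, map_sum] at h
    have h2 : ∀ i, Pop M (lm (e j) (lm (e i) (y i : M))) = (e j * e i).co 0 • (y i : M) := by
      intro i
      rw [nucleus_mul (y i).2, Pop_nucleus (y i).2]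
    simp only [h2, co_conj_mul, ite_smul, zero_smul, Finset.sum_ite_eq', Finset.mem_univ,
      if_true] at h
    apply Subtype.ext
    split_ifs at h with hj
    · simpa using h
    · simpa using h
  · intro x
    refine ⟨fun i => if i = 0 then ⟨Pop M x, Pop_mem x⟩ else -⟨Pop M (Lop M i x), Pop_mem _⟩, ?_⟩
    rw [assemble_apply, Fin.sum_univ_succ]
    have h := LinearMap.congr_fun (Pop_sum (M := M)) x
    rw [LinearMap.sub_apply, LinearMap.sum_apply, Module.End.one_apply] at h
    conv_rhs => rw [← h]
    rw [sub_eq_add_neg, ← Finset.sum_neg_distrib]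
    congr 1
    · rw [Octonion.e_zero, one_lm, if_pos rfl]
    · apply Finset.sum_congr rfl
      intro i _
      rw [if_neg (Fin.succ_ne_zero i)]
      simp [Lop]

variable (M) in
/-- The components of an element: `x = ∑ i, eᵢ xᵢ` with unique associative elements
`xᵢ = components M x i`. -/
def components : M ≃ₗ[ℝ] (Fin 8 → nucleus M) :=
  (LinearEquiv.ofBijective (assemble M) assemble_bijective).symm

theorem sum_components (x : M) : ∑ i, lm (e i) (components M x i : M) = x := by
  rw [← assemble_apply]
  exact (LinearEquiv.ofBijective (assemble M) assemble_bijective).apply_symm_apply x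

theorem components_lm (y : nucleus M) (p : Octonion) (i : Fin 8) :
    components M (lm p (y : M)) i = p.co i • y := by
  have h : components M (assemble M (fun i => p.co i • y)) = fun i => p.co i • y :=
    (LinearEquiv.ofBijective (assemble M) assemble_bijective).symm_apply_apply _
  have h2 : assemble M (fun i => p.co i • y) = lm p (y : M) := by
    rw [assemble_apply]
    conv_rhs => rw [Octonion.eq_sum p]
    simp [map_sum, LinearMap.sum_apply]
  rw [← h2, h]

variable (M) in
/-- The real part operator: the projection of `M = ⨁ eᵢ 𝒜(M)` onto the nucleus `𝒜(M)`. -/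
def realPart : M →ₗ[ℝ] nucleus M := LinearMap.proj 0 ∘ₗ (components M).toLinearMap

theorem realPart_apply (x : M) : realPart M x = components M x 0 := rfl

theorem realPart_lm (y : nucleus M) (p : Octonion) :
    realPart M (lm p (y : M)) = p.co 0 • y := components_lm y p 0

theorem realPart_assoc (p q : Octonion) (x : M) :
    realPart M (lm (p * q) x - lm p (lm q x)) = 0 := by
  rw [← sum_components x]
  simp only [map_sum, ← Finset.sum_sub_distrib]
  apply Finset.sum_eq_zero
  intro i _
  rw [nucleus_mul (components M x i).2, nucleus_mul (components M x i).2,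
    nucleus_mul (components M x i).2, ← LinearMap.sub_apply, ← map_sub, realPart_lm,
    Octonion.co_assoc_zero, zero_smul]

variable {M' M'' : Type u} [AddCommGroup M'] [Module ℝ M'] [OctBimodule M']
  [AddCommGroup M''] [Module ℝ M''] [OctBimodule M'']

/-! ## Para-linear maps -/

/-- The second left associator `A_p(x, f) = f (p x) - p f(x)`. -/
def secondAssoc (p : Octonion) (f : M →ₗ[ℝ] M') : M →ₗ[ℝ] M' := f ∘ₗ lm p - lm p ∘ₗ f

theorem secondAssoc_apply (p : Octonion) (f : M →ₗ[ℝ] M') (x : M) :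
    secondAssoc p f x = f (lm p x) - lm p (f x) := rfl

variable (M M') in
/-- The real vector space of left para-linear maps `M → M'`: real linear maps `f` with
`Re A_p(x, f) = 0` for all octonions `p` and all `x`. -/
def HomLO : Submodule ℝ (M →ₗ[ℝ] M') where
  carrier := {f | ∀ (p : Octonion) (x : M), realPart M' (secondAssoc p f x) = 0}
  zero_mem' := by intro p x; simp [secondAssoc_apply]
  add_mem' := by
    intro f g hf hg p x
    have h1 := hf p x
    have h2 := hg p x
    have h3 : secondAssoc p (f + g) x = secondAssoc p f x + secondAssoc p g x := by
      simp only [secondAssoc_apply, LinearMap.add_apply, map_add]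
      abel
    rw [h3, map_add, h1, h2, add_zero]
  smul_mem' := by
    intro r f hf p x
    have h1 := hf p x
    rw [secondAssoc_apply] at *
    simp only [LinearMap.smul_apply, map_smul]
    rw [← smul_sub, map_smul, h1, smul_zero]

/-- The (left) regular composition of real linear maps,
`(f ⊚ g)(x) = f (g x) - ∑ j = 1..7, eⱼ Re (f (A_{eⱼ}(x, g)))`. -/
def regComp (f : M' →ₗ[ℝ] M'') (g : M →ₗ[ℝ] M') : M →ₗ[ℝ] M'' :=
  f ∘ₗ g - ∑ j : Fin 7, lm (e j.succ) ∘ₗ (nucleus M'').subtype ∘ₗ realPart M'' ∘ₗ f ∘ₗ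
    secondAssoc (e j.succ) g

theorem regComp_apply (f : M' →ₗ[ℝ] M'') (g : M →ₗ[ℝ] M') (x : M) :
    regComp f g x = f (g x) -
      ∑ j : Fin 7, lm (e j.succ) (realPart M'' (f (secondAssoc (e j.succ) g x)) : M'') := by
  simp [regComp]

theorem secondAssoc_eq_sum (p : Octonion) (g : M →ₗ[ℝ] M') (x : M) :
    secondAssoc p g x = ∑ j : Fin 7, p.co j.succ • secondAssoc (e j.succ) g x := by
  have h : secondAssoc p g x = ∑ j, p.co j • secondAssoc (e j) g x := by
    simp only [secondAssoc_apply]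
    conv_lhs => rw [Octonion.eq_sum p]
    simp only [map_sum, LinearMap.sum_apply, map_smul, LinearMap.smul_apply,
      ← Finset.sum_sub_distrib, smul_sub]
  rw [h, Fin.sum_univ_succ, secondAssoc_apply, Octonion.e_zero, one_lm, one_lm, sub_self,
    smul_zero, zero_add]

theorem co_mul_e (p : Octonion) (j : Fin 7) : (p * e j.succ).co 0 = -p.co j.succ := by
  fin_cases j <;> simp [co_mul0, co_e]

/-- Regular composition with a para-linear outer map gives a para-linear map. -/
theorem regComp_mem {f : M' →ₗ[ℝ] M''} (hf : f ∈ HomLO M' M'') (g : M →ₗ[ℝ] M') :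
    regComp f g ∈ HomLO M M'' := by
  intro p x
  have h1 : realPart M'' (f (lm p (g x))) = realPart M'' (lm p (f (g x))) := by
    have := hf p (g x)
    rw [secondAssoc_apply, map_sub] at this
    exact sub_eq_zero.mp this
  have h2 : g (lm p x) = lm p (g x) + secondAssoc p g x := by rw [secondAssoc_apply]; abel
  have h3 : realPart M'' (f (secondAssoc p g x)) =
      ∑ j : Fin 7, p.co j.succ • realPart M'' (f (secondAssoc (e j.succ) g x)) := by
    rw [secondAssoc_eq_sum]; simp only [map_sum, map_smul]
  rw [secondAssoc_apply, map_sub, regComp_apply, regComp_apply, map_sub, map_sub, map_sub, h2,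
    map_add, map_add, h1, h3]
  simp only [map_sum, realPart_lm, nucleus_mul (Subtype.prop _), co_mul_e]
  have h4 : ∀ j : Fin 7, (e j.succ).co 0 = 0 := by
    intro j; rw [co_e, if_neg (Fin.succ_ne_zero j).symm]
  simp only [h4, zero_smul, Finset.sum_const_zero, neg_smul, Finset.sum_neg_distrib]
  abel

/-- Regular composition of para-linear maps. -/
def comp (f : HomLO M' M'') (g : HomLO M M') : HomLO M M'' :=
  ⟨regComp f.1 g.1, regComp_mem f.2 g.1⟩

variable (M) in
/-- The identity map. -/
def idLO : HomLO M M := ⟨LinearMap.id, by intro p x; simp [secondAssoc_apply]⟩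

theorem comp_idLO (f : HomLO M M') : comp f (idLO M) = f := by
  apply Subtype.ext
  ext x
  change regComp f.1 LinearMap.id x = f.1 x
  rw [regComp_apply]
  simp [secondAssoc_apply]

theorem idLO_comp (f : HomLO M M') : comp (idLO M') f = f := by
  apply Subtype.ext
  ext x
  change regComp LinearMap.id f.1 x = f.1 x
  rw [regComp_apply]
  simp only [LinearMap.id_apply, f.2 _ x]
  simp

/-- The underlying linear map of the para-linear extension: `∑ i, eᵢ xᵢ ↦ ∑ i, eᵢ g(xᵢ)` for
`xᵢ` in the nucleus. -/
def extLin (g : nucleus M →ₗ[ℝ] M') : M →ₗ[ℝ] M' :=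
  ∑ i, lm (e i) ∘ₗ g ∘ₗ LinearMap.proj i ∘ₗ (components M).toLinearMap

theorem extLin_apply (g : nucleus M →ₗ[ℝ] M') (x : M) :
    extLin g x = ∑ i, lm (e i) (g (components M x i)) := by
  simp [extLin]

/-- The defining property of the para-linear extension. -/
theorem extLin_lm (g : nucleus M →ₗ[ℝ] M') (p : Octonion) (x : nucleus M) :
    extLin g (lm p (x : M)) = lm p (g x) := by
  rw [extLin_apply]
  conv_rhs => rw [Octonion.eq_sum p]
  simp [components_lm, map_sum, LinearMap.sum_apply]

theorem extLin_mem (g : nucleus M →ₗ[ℝ] M') : extLin g ∈ HomLO M M' := by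
  intro p x
  rw [secondAssoc_apply, ← sum_components x]
  simp only [map_sum, ← Finset.sum_sub_distrib]
  apply Finset.sum_eq_zero
  intro i _
  rw [nucleus_mul (components M x i).2, extLin_lm, extLin_lm]
  exact realPart_assoc _ _ _

/-- The (left) para-linear extension `l-ext g`: the para-linear map with `(l-ext g)(p x) = p g(x)`
for all octonions `p` and all `x` in the nucleus. -/
def lExt (g : nucleus M →ₗ[ℝ] M') : HomLO M M' := ⟨extLin g, extLin_mem g⟩

/-! ## The tensor product -/

open TensorProduct

/-- For a real vector space `V`, the bimodule `V ⊗ 𝕆` with `p (v ⊗ q) = v ⊗ p q` and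
`(v ⊗ q) p = v ⊗ q p`. -/
instance tensorBimodule (V : Type u) [AddCommGroup V] [Module ℝ V] :
    OctBimodule (V ⊗[ℝ] Octonion) where
  lm := LinearMap.lTensorHom V ∘ₗ LinearMap.mul ℝ Octonion
  rm := LinearMap.lTensorHom V ∘ₗ (LinearMap.mul ℝ Octonion).flip
  one_lm m := by
    induction m with
    | zero => simp
    | tmul v q => simp
    | add a b ha hb => rw [map_add, ha, hb]
  one_rm m := by
    induction m with
    | zero => simp
    | tmul v q => simp
    | add a b ha hb => rw [map_add, ha, hb]
  left_alt p q m := by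
    induction m with
    | zero => simp
    | tmul v r =>
      simp only [LinearMap.comp_apply, LinearMap.coe_lTensorHom, LinearMap.lTensor_tmul,
        LinearMap.mul_apply', ← TensorProduct.tmul_sub, ← TensorProduct.tmul_neg]
      rw [Octonion.left_alt]
    | add a b ha hb =>
      simp only [map_add]
      rw [add_sub_add_comm, ha, hb, add_sub_add_comm, neg_add]
  assoc_eq₁ p q m := by
    induction m with
    | zero => simp
    | tmul v r =>
      simp only [LinearMap.comp_apply, LinearMap.coe_lTensorHom, LinearMap.lTensor_tmul,
        LinearMap.mul_apply', LinearMap.flip_apply, ← TensorProduct.tmul_sub]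
      rw [Octonion.assoc_cyc]
    | add a b ha hb =>
      simp only [map_add]
      rw [add_sub_add_comm, ha, hb, add_sub_add_comm]
  assoc_eq₂ p q m := by
    induction m with
    | zero => simp
    | tmul v r =>
      simp only [LinearMap.comp_apply, LinearMap.coe_lTensorHom, LinearMap.lTensor_tmul,
        LinearMap.mul_apply', LinearMap.flip_apply, ← TensorProduct.tmul_sub]
      rw [← Octonion.assoc_cyc q r p]
    | add a b ha hb =>
      simp only [map_add]
      rw [add_sub_add_comm, ha, hb, add_sub_add_comm]

section TensorNucleus

variable (V : Type u) [AddCommGroup V] [Module ℝ V]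

theorem lm_tmul (p q : Octonion) (v : V) :
    lm p (v ⊗ₜ[ℝ] q) = v ⊗ₜ[ℝ] (p * q) := by
  change LinearMap.lTensor V _ _ = _
  rw [LinearMap.lTensor_tmul]; rfl

/-- The map `v ↦ v ⊗ 1` from `V` to the nucleus of `V ⊗ 𝕆`. -/
def toNucleus : V →ₗ[ℝ] nucleus (V ⊗[ℝ] Octonion) :=
  LinearMap.codRestrict (nucleus (V ⊗[ℝ] Octonion)) ((TensorProduct.mk ℝ V Octonion).flip 1) (by
    intro v p q
    change lm (p * q) (v ⊗ₜ[ℝ] (1 : Octonion)) - lm p (lm q (v ⊗ₜ[ℝ] (1 : Octonion))) = 0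
    rw [lm_tmul, lm_tmul, lm_tmul, mul_one, mul_one, sub_self])

theorem toNucleus_coe (v : V) :
    (toNucleus V v : V ⊗[ℝ] Octonion) = v ⊗ₜ[ℝ] (1 : Octonion) := rfl

theorem toNucleus_bijective : Function.Bijective (toNucleus V) := by
  constructor
  · intro v w h
    have h2 := congrArg (fun z : nucleus (V ⊗[ℝ] Octonion) =>
      TensorProduct.rid ℝ V (LinearMap.lTensor V (coL 0) (z : V ⊗[ℝ] Octonion))) h
    simpa [toNucleus_coe, co_one] using h2
  · intro y
    have h : ∀ z : V ⊗[ℝ] Octonion, ∃ v, toNucleus V v = realPart _ z := by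
      intro z
      induction z with
      | zero => exact ⟨0, by simp⟩
      | tmul v q =>
        refine ⟨q.co 0 • v, ?_⟩
        have := realPart_lm (toNucleus V v) q
        rw [toNucleus_coe, lm_tmul, mul_one] at this
        rw [this, map_smul]
      | add a b ha hb =>
        obtain ⟨v, hv⟩ := ha
        obtain ⟨w, hw⟩ := hb
        exact ⟨v + w, by rw [map_add, map_add, hv, hw]⟩
    obtain ⟨v, hv⟩ := h y
    refine ⟨v, hv.trans ?_⟩
    have := realPart_lm y 1
    rwa [one_lm, co_one, if_pos rfl, one_smul] at this

/-- The identification `Re (V ⊗ 𝕆) = V`, sending `v ⊗ 1` to `v`. -/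
def nucleusTensor : nucleus (V ⊗[ℝ] Octonion) ≃ₗ[ℝ] V :=
  (LinearEquiv.ofBijective (toNucleus V) (toNucleus_bijective V)).symm

end TensorNucleus

variable (M M') in
/-- The octonionic tensor product `M ⊗_𝕆 M' = (Re M ⊗ Re M') ⊗ 𝕆` over the reals. -/
def OTensor : Type u := (nucleus M ⊗[ℝ] nucleus M') ⊗[ℝ] Octonion

instance : AddCommGroup (OTensor M M') :=
  inferInstanceAs (AddCommGroup ((nucleus M ⊗[ℝ] nucleus M') ⊗[ℝ] Octonion))

instance : Module ℝ (OTensor M M') :=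
  inferInstanceAs (Module ℝ ((nucleus M ⊗[ℝ] nucleus M') ⊗[ℝ] Octonion))

instance : OctBimodule (OTensor M M') :=
  inferInstanceAs (OctBimodule ((nucleus M ⊗[ℝ] nucleus M') ⊗[ℝ] Octonion))

variable (M M') in
/-- The canonical bilinear map `(t, p) ↦ t ⊗ p` into `(Re M ⊗ Re M') ⊗ 𝕆`. -/
def OTensor.mk : nucleus M ⊗[ℝ] nucleus M' →ₗ[ℝ] Octonion →ₗ[ℝ] OTensor M M' :=
  TensorProduct.mk ℝ (nucleus M ⊗[ℝ] nucleus M') Octonion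

variable (M M') in
/-- The identification `Re (M ⊗_𝕆 M') = Re M ⊗ Re M'`, sending `t ⊗ 1` to `t`. -/
def OTensor.nucleusEquiv : nucleus (OTensor M M') ≃ₗ[ℝ] nucleus M ⊗[ℝ] nucleus M' :=
  nucleusTensor (nucleus M ⊗[ℝ] nucleus M')

/-- The element `m ⊗_𝕆 m' = ∑ i j, (mᵢ ⊗ m'ⱼ) ⊗ eᵢ eⱼ`. -/
def otmul (m : M) (m' : M') : OTensor M M' :=
  ∑ i, ∑ j, OTensor.mk M M' (components M m i ⊗ₜ[ℝ] components M' m' j) (e i * e j)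

variable (M) in
/-- The map `f_M : Re M ⊗ Re X → M ⊗_𝕆 X'`, `m ⊗ x ↦ m ⊗_𝕆 f(x)`. -/
def fM (f : M' →ₗ[ℝ] M'') : nucleus M ⊗[ℝ] nucleus M' →ₗ[ℝ] OTensor M M'' :=
  TensorProduct.lift (LinearMap.mk₂ ℝ (fun (m : nucleus M) (x : nucleus M') =>
      otmul (m : M) (f (x : M')))
    (by intros; simp [otmul, TensorProduct.add_tmul, Finset.sum_add_distrib])
    (by intros; simp [otmul, ← TensorProduct.smul_tmul', Finset.smul_sum])
    (by intros; simp [otmul, TensorProduct.tmul_add, Finset.sum_add_distrib])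
    (by intros; simp [otmul, Finset.smul_sum]))

theorem fM_tmul (f : M' →ₗ[ℝ] M'') (m : nucleus M) (x : nucleus M') :
    fM M f (m ⊗ₜ[ℝ] x) = otmul (m : M) (f (x : M')) := rfl

variable (M) in
/-- The para-linear map `l-ext f_M : M ⊗_𝕆 X → M ⊗_𝕆 X'` induced by `f : X → X'`, through
`Re (M ⊗_𝕆 X) = Re M ⊗ Re X`. -/
def lExtfM (f : HomLO M' M'') : HomLO (OTensor M M') (OTensor M M'') :=
  lExt (fM M f.1 ∘ₗ (OTensor.nucleusEquiv M M').toLinearMap)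

end Structure

/-! ## Non-associative categories and functors -/

universe v w v' w'

/-- A non-associative category: composition has identities but need not be associative. -/
structure NonAssocCategory where
  Obj : Type v
  Hom : Obj → Obj → Type w
  comp : ∀ {X Y Z : Obj}, Hom Y Z → Hom X Y → Hom X Z
  id : ∀ X : Obj, Hom X X
  comp_id : ∀ {X Y : Obj} (f : Hom X Y), comp f (id X) = f
  id_comp : ∀ {X Y : Obj} (f : Hom X Y), comp (id Y) f = f

/-- The data of a covariant functor: an assignment on objects and one on morphisms. -/
structure FunctorData (C : NonAssocCategory.{v, w}) (D : NonAssocCategory.{v', w'}) where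
  obj : C.Obj → D.Obj
  map : ∀ {X Y : C.Obj}, C.Hom X Y → D.Hom (obj X) (obj Y)

/-- The axioms of a covariant functor: compositions and identities are preserved. -/
structure FunctorData.IsCovariantFunctor {C : NonAssocCategory.{v, w}}
    {D : NonAssocCategory.{v', w'}} (T : FunctorData C D) : Prop where
  map_comp : ∀ {X Y Z : C.Obj} (g : C.Hom Y Z) (f : C.Hom X Y),
    T.map (C.comp g f) = D.comp (T.map g) (T.map f)
  map_id : ∀ X : C.Obj, T.map (C.id X) = D.id (T.obj X)

/-- A bundled bimodule over the octonions. -/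
structure OBimod where
  carrier : Type u
  [addCommGroup : AddCommGroup carrier]
  [module : Module ℝ carrier]
  [bimodule : OctBimodule carrier]

attribute [instance] OBimod.addCommGroup OBimod.module OBimod.bimodule

/-- The non-associative category `𝓛𝓞`: octonionic bimodules, left para-linear maps and left regular
compositions. -/
def LO : NonAssocCategory.{u + 1, u} where
  Obj := OBimod.{u}
  Hom X Y := HomLO X.carrier Y.carrier
  comp f g := comp f g
  id X := idLO X.carrier
  comp_id f := comp_idLO f
  id_comp f := idLO_comp f

/-- The assignment `M ⊗^{ll}_𝕆 -`: `X ↦ M ⊗_𝕆 X` and `f ↦ l-ext f_M`. -/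
def tensorFunctor (M : OBimod.{u}) : FunctorData LO.{u} LO.{u} where
  obj := fun X : OBimod.{u} => OBimod.mk (OTensor M.carrier X.carrier)
  map := fun {X Y : OBimod.{u}} (f : HomLO X.carrier Y.carrier) => lExtfM M.carrier f

end OctCat
end

/-! The proof rests on the maps `otmulLeft X m : x ↦ m ⊗_𝕆 x` with `m` in the nucleus of `M`. For
such `m` the only nonzero component of `m` is the zeroth one, so no factor `eᵢ` with `i ≠ 0` is
placed in front of the octonion coordinates of `x`. The map is therefore left 𝕆-linear in `x`
(`otmulLeft_lm`). It sends real elements to real elements and commutes with the real part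
(`realPart_otmulLeft`). As `m` varies, the images span `M ⊗_𝕆 X`, because `m ⊗_𝕆 (p y) = (m ⊗ y) ⊗
p` for real `y` (`OTensor.hom_ext`).

The second ingredient is that a para-linear map is the para-linear extension of its own restriction
to the nucleus: `f (p y) = p f(y)` for real `y` (`HomLO.map_lm`). Since `f` and `l-ext f_M` both
have this property, and `otmulLeft` is 𝕆-linear, the formula defining `f_M` on real tensors
propagates to the naturality square `(l-ext f_M)(m ⊗_𝕆 x) = m ⊗_𝕆 f(x)` for every `x`
(`lExtfM_otmulLeft`).

The regular composition is built only from application of maps, left multiplication by `eⱼ`, the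
real part and the associator `A_p`, which itself needs only maps and left multiplication. Each of
these is carried through `m ⊗_𝕆 -`. Hence both sides of the composition law take the value `m ⊗_𝕆 (f
⊚ g)(x)` at `m ⊗_𝕆 x`, and the spanning property finishes the argument. Identities are treated in
the same way. Associativity of composition plays no role. -/

noncomputable section

namespace OctCat

open Octonion OctBimodule TensorProduct

/-! ### Para-linear maps are determined by their values on the nucleus. -/

section ParaLinear

variable {M M' M'' : Type u} [AddCommGroup M] [Module ℝ M] [OctBimodule M]
  [AddCommGroup M'] [Module ℝ M'] [OctBimodule M'] [AddCommGroup M''] [Module ℝ M'']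
  [OctBimodule M'']

/-- An element all of whose left multiples have vanishing real part is zero. -/
theorem eq_zero_of_realPart_lm {x : M} (h : ∀ p : Octonion, realPart M (lm p x) = 0) : x = 0 := by
  have hc : ∀ i, components M x i = 0 := by
    intro i
    -- Multiplying by `e i` brings the `i`-th component into real position: `e i * e k` has a
    -- nonzero real coordinate only for `k = i`, where it is `±1`. So the hypothesis reads `± xᵢ =
    -- 0`.
    have hi := h (e i)
    rw [← sum_components x] at hi
    simp only [map_sum, nucleus_mul (Subtype.prop _), realPart_lm, co_conj_mul, ite_smul,
      zero_smul, Finset.sum_ite_eq', Finset.mem_univ, if_true] at hi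
    split_ifs at hi with h0
    · simpa using hi
    · simpa using hi
  rw [← sum_components x]
  simp [hc]

theorem realPart_lm_of_mem {f : M →ₗ[ℝ] M'} (hf : f ∈ HomLO M M') (p : Octonion) (x : M) :
    realPart M' (f (lm p x)) = realPart M' (lm p (f x)) := by
  have h := hf p x
  rw [secondAssoc_apply, map_sub] at h
  exact sub_eq_zero.mp h

/-- Associators have zero real part, so the real part cannot see the bracketing even when `x` is not
associative. -/
theorem realPart_lm_lm (p q : Octonion) (x : M) :
    realPart M (lm p (lm q x)) = realPart M (lm (p * q) x) := by
  have h := realPart_assoc p q x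
  rw [map_sub] at h
  exact (sub_eq_zero.mp h).symm

/-- A para-linear map commutes with octonions acting on associative elements. -/
theorem HomLO.map_lm (f : HomLO M M') (p : Octonion) (y : nucleus M) :
    f.1 (lm p (y : M)) = lm p (f.1 (y : M)) := by
  -- The two sides are compared through the real parts of all their left multiples by `q`. Under
  -- `Re`, para-linearity moves octonions across `f` and bracketing is irrelevant, while `q (p y) =
  -- (q p) y` because `y` is associative. Both sides become `Re ((q p) f(y))`.
  rw [← sub_eq_zero]
  apply eq_zero_of_realPart_lm
  intro q
  rw [map_sub, map_sub, ← realPart_lm_of_mem f.2, nucleus_mul y.2, realPart_lm_of_mem f.2,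
    realPart_lm_lm, sub_self]

end ParaLinear

/-! ### Tensoring with an associative element, and functoriality of the tensor product. -/

section Tensor

variable {M X X' X'' : Type u} [AddCommGroup M] [Module ℝ M] [OctBimodule M]
  [AddCommGroup X] [Module ℝ X] [OctBimodule X] [AddCommGroup X'] [Module ℝ X'] [OctBimodule X']
  [AddCommGroup X''] [Module ℝ X''] [OctBimodule X'']

theorem OTensor.lm_mk (p q : Octonion) (t : nucleus M ⊗[ℝ] nucleus X) :
    lm p (OTensor.mk M X t q) = OTensor.mk M X t (p * q) :=
  lm_tmul _ p q t

theorem components_coe (y : nucleus M) (i : Fin 8) :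
    components M (y : M) i = (if i = 0 then (1 : ℝ) else 0) • y := by
  have h := components_lm y 1 i
  rwa [one_lm, co_one] at h

variable (X) in
/-- The real linear map `x ↦ m ⊗_𝕆 x` for an associative element `m`. -/
def otmulLeft (m : nucleus M) : X →ₗ[ℝ] OTensor M X where
  toFun x := otmul (m : M) x
  map_add' _ _ := by simp [otmul, TensorProduct.tmul_add, Finset.sum_add_distrib]
  map_smul' _ _ := by simp [otmul, Finset.smul_sum]

theorem otmulLeft_apply (m : nucleus M) (x : X) : otmulLeft X m x = otmul (m : M) x := rfl

/-- Of the double sum defining `⊗_𝕆` only the row `i = 0` survives, with `e 0 = 1`, and the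
remaining sum over `j` reassembles `p` from its coordinates. This is the computation behind the
linearity and spanning properties below. -/
theorem otmulLeft_lm_coe (m : nucleus M) (p : Octonion) (y : nucleus X) :
    otmulLeft X m (lm p (y : X)) = OTensor.mk M X (m ⊗ₜ[ℝ] y) p := by
  conv_rhs => rw [Octonion.eq_sum p]
  -- An associative `m` has no components beyond the zeroth.
  rw [otmulLeft_apply, otmul, Finset.sum_eq_single 0]
  · simp [components_coe, components_lm, Octonion.e_zero]
  · intro i _ hi
    simp [components_coe, hi]
  · simp

theorem otmulLeft_coe (m : nucleus M) (y : nucleus X) :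
    otmulLeft X m (y : X) = OTensor.mk M X (m ⊗ₜ[ℝ] y) 1 := by
  rw [← otmulLeft_lm_coe, one_lm]

/-- On `x = ∑ eᵢ xᵢ` with `xᵢ` real, `p (eᵢ xᵢ) = (p eᵢ) xᵢ`, and both sides become `∑ (m ⊗ xᵢ) ⊗ p
eᵢ`. Associativity of `m` matters: a factor `eₖ` coming from `m` would have to be moved past `p`. -/
theorem otmulLeft_lm (m : nucleus M) (p : Octonion) (x : X) :
    otmulLeft X m (lm p x) = lm p (otmulLeft X m x) := by
  rw [← sum_components x]
  simp only [map_sum]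
  refine Finset.sum_congr rfl fun i _ => ?_
  rw [nucleus_mul (components X x i).2, otmulLeft_lm_coe, otmulLeft_lm_coe, OTensor.lm_mk]

theorem otmulLeft_mem_nucleus (m : nucleus M) (y : nucleus X) :
    otmulLeft X m (y : X) ∈ nucleus (OTensor M X) := by
  intro p q
  rw [← otmulLeft_lm, ← otmulLeft_lm, ← otmulLeft_lm, nucleus_mul y.2, sub_self]

/-- By 𝕆-linearity, `m ⊗_𝕆 x = ∑ eᵢ (m ⊗_𝕆 xᵢ)` with every `m ⊗_𝕆 xᵢ` real. This is already the
decomposition of `m ⊗_𝕆 x` into components, so its real part is the term `i = 0`. -/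
theorem realPart_otmulLeft (m : nucleus M) (x : X) :
    (realPart (OTensor M X) (otmulLeft X m x) : OTensor M X) =
      otmulLeft X m (realPart X x : X) := by
  conv_lhs => rw [← sum_components x]
  have h : ∀ i, realPart (OTensor M X) (otmulLeft X m (lm (e i) (components X x i : X))) =
      (e i).co 0 • ⟨_, otmulLeft_mem_nucleus m (components X x i)⟩ := by
    intro i
    rw [otmulLeft_lm]
    exact realPart_lm ⟨_, otmulLeft_mem_nucleus m (components X x i)⟩ (e i)
  rw [map_sum, map_sum, Finset.sum_congr rfl fun i _ => h i, Finset.sum_eq_single 0]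
  · simp [co_e, realPart_apply]
  · intro i _ hi
    rw [co_e, if_neg hi.symm, zero_smul]
  · simp

/-- Real linear maps on `M ⊗_𝕆 X` are determined by their values on the elements `m ⊗_𝕆 x` with
`m` associative. -/
theorem OTensor.hom_ext {V : Type*} [AddCommGroup V] [Module ℝ V] {F G : OTensor M X →ₗ[ℝ] V}
    (h : ∀ (m : nucleus M) (x : X), F (otmulLeft X m x) = G (otmulLeft X m x)) : F = G := by
  -- Composing with the identity presents the domain `OTensor M X` as the threefold tensor product
  -- that it unfolds to, so that `TensorProduct.ext_threefold` applies.
  have key : (F ∘ₗ (LinearMap.id : (nucleus M ⊗[ℝ] nucleus X) ⊗[ℝ] Octonion →ₗ[ℝ] OTensor M X)) =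
      G ∘ₗ (LinearMap.id : (nucleus M ⊗[ℝ] nucleus X) ⊗[ℝ] Octonion →ₗ[ℝ] OTensor M X) := by
    apply TensorProduct.ext_threefold
    intro m y p
    -- The pure tensor `(m ⊗ y) ⊗ p` is `m ⊗_𝕆 (p y)`.
    have := h m (lm p (y : X))
    rw [otmulLeft_lm_coe] at this
    exact this
  exact key

theorem OTensor.nucleusEquiv_otmulLeft (m : nucleus M) (y : nucleus X) :
    OTensor.nucleusEquiv M X ⟨_, otmulLeft_mem_nucleus m y⟩ = m ⊗ₜ[ℝ] y := by
  have h : (⟨_, otmulLeft_mem_nucleus m y⟩ : nucleus (OTensor M X)) =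
      (OTensor.nucleusEquiv M X).symm (m ⊗ₜ[ℝ] y) := Subtype.ext (otmulLeft_coe m y)
  rw [h, LinearEquiv.apply_symm_apply]

/-- Naturality: `(l-ext f_M)(m ⊗_𝕆 x) = m ⊗_𝕆 f(x)` for associative `m` and arbitrary `x`. -/
theorem lExtfM_otmulLeft (f : HomLO X X') (m : nucleus M) (x : X) :
    (lExtfM M f).1 (otmulLeft X m x) = otmulLeft X' m (f.1 x) := by
  rw [← sum_components x]
  simp only [map_sum]
  refine Finset.sum_congr rfl fun i _ => ?_
  -- `HomLO.map_lm` is where para-linearity of `f` enters. It pulls `e i` out of `f` on the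
  -- right-hand side; the claim that is left concerns the real element `m ⊗_𝕆 xᵢ`, on which the
  -- extension is given by `f_M`.
  rw [otmulLeft_lm, HomLO.map_lm, otmulLeft_lm]
  refine (extLin_lm _ (e i) ⟨_, otmulLeft_mem_nucleus m (components X x i)⟩).trans ?_
  rw [LinearMap.comp_apply, LinearEquiv.coe_coe, OTensor.nucleusEquiv_otmulLeft, fM_tmul]
  rfl

/-- The associator is a difference of two composites of the map with left multiplication by `p`, and
`m ⊗_𝕆 -` intertwines both operations. -/
theorem secondAssoc_lExtfM_otmulLeft (p : Octonion) (f : HomLO X X') (m : nucleus M) (x : X) :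
    secondAssoc p (lExtfM M f).1 (otmulLeft X m x) = otmulLeft X' m (secondAssoc p f.1 x) := by
  rw [secondAssoc_apply, secondAssoc_apply, ← otmulLeft_lm, lExtfM_otmulLeft, lExtfM_otmulLeft,
    map_sub, otmulLeft_lm m p (f.1 x)]

/-- It suffices to evaluate at `m ⊗_𝕆 x`, where `m ⊗_𝕆 -` can be pulled outward through every
operation in the formula for `⊚`. -/
theorem comp_lExtfM (f : HomLO X' X'') (g : HomLO X X') :
    comp (lExtfM M f) (lExtfM M g) = lExtfM M (comp f g) := by
  apply Subtype.ext
  apply OTensor.hom_ext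
  intro m x
  rw [lExtfM_otmulLeft]
  change regComp _ _ _ = otmulLeft X'' m (regComp _ _ _)
  rw [regComp_apply, regComp_apply, map_sub, map_sum, lExtfM_otmulLeft, lExtfM_otmulLeft]
  congr 1
  refine Finset.sum_congr rfl fun j _ => ?_
  -- In the `j`-th correction term, `m ⊗_𝕆 -` passes in turn through the associator of `g`, the map
  -- `f`, the real part and the multiplication by `eⱼ`.
  rw [secondAssoc_lExtfM_otmulLeft, lExtfM_otmulLeft, realPart_otmulLeft, otmulLeft_lm]

theorem lExtfM_idLO : lExtfM M (idLO X) = idLO (OTensor M X) := by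
  apply Subtype.ext
  apply OTensor.hom_ext
  intro m x
  rw [lExtfM_otmulLeft]
  rfl

end Tensor

end OctCat
end

theorem mainTheorem8 (M : OctCat.OBimod.{u}) :
    (∀ (X X' X'' : OctCat.OBimod.{u}) (f : OctCat.HomLO X'.carrier X''.carrier)
        (g : OctCat.HomLO X.carrier X'.carrier),
      OctCat.comp (OctCat.lExtfM M.carrier f) (OctCat.lExtfM M.carrier g) =
        OctCat.lExtfM M.carrier (OctCat.comp f g)) ∧
    (OctCat.tensorFunctor M).IsCovariantFunctor := by
  refine ⟨fun _ _ _ f g => OctCat.comp_lExtfM f g, ⟨?_, ?_⟩⟩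
  -- The ascriptions unfold the objects and morphisms of `LO` to bimodules and para-linear maps. In
  -- `IsCovariantFunctor` the outer map is called `g`, and the equation runs in the opposite
  -- direction to `comp_lExtfM`.
  · intro (X : OctCat.OBimod.{u}) (Y : OctCat.OBimod.{u}) (Z : OctCat.OBimod.{u})
      (g : OctCat.HomLO Y.carrier Z.carrier) (f : OctCat.HomLO X.carrier Y.carrier)
    exact (OctCat.comp_lExtfM g f).symm
  · intro (X : OctCat.OBimod.{u})
    exact OctCat.lExtfM_idLO (X := X.carrier)
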